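/- **Theorem.** Let $(M,F)$ be a homogeneous Finsler space: $M$ is a smooth $n$-dimensional manifold, $F$ is a Finsler metric on $M$ (smooth and positive on $TM\setminus 0$, positively homogeneous of degree one, not necessarily reversible, with positive definite fundamental tensor $g_{ij}(y)=\frac12[F^2]_{y^iy^j}$ for $y\ne 0$), and $G$ is a (second countable) Lie group acting smoothly, transitively and by isometries of $F$ on $M$. Let $x\in M$ and let $H$ be the isotropy subgroup of $G$ at $x$, so that $M=G/H$. Let $\mathfrak g$ and $\mathfrak h$ be the Lie algebras of $G$ and $H$ (with the bracket of left invariant vector fields). Fix any linear complement $\mathfrak m$ of $\mathfrak h$ in $\mathfrak g$, let $[\cdot,\cdot]_{\mathfrak m}$ be the bracket of $\mathfrak g$ followed by the projection of $\mathfrak g=\mathfrak h\oplus\mathfrak m$ onto $\mathfrak m$, and identify $\mathfrak m$ with $T_xM$ by $v\mapsto \frac{d}{dt}\big|_{t=0}\exp(tv)\cdot x$. For nonzero $y \in\mathfrak m$ let $\langle\cdot,\cdot\rangle_y$ be the inner product on $\mathfrak m$ given by the fundamental tensor of $F|_{T_xM}$ at $y$. For a basis $\{\hat v_i\}$ of $\mathfrak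 m$ with linear coordinates $y=y^i\hat v_i$, let $g_{ij}(y)=\langle\hat v_i,\hat v_j\rangle_y$, let $(g^{ij})$ be the inverse matrix, and let $$\nabla^{g_{ij}}\ln\sqrt{\det(g_{pq})}\,(y)=g^{il}(y)\,\frac{\partial \ln\sqrt{\det(g_{pq})}}{\partial y^i}(y)\;\hat v_l\in\mathfrak m .$$ In local coordinates $(x^i)$ on $M$, with $y=y^i\partial_{x^i}$ and $g_{ij}=\frac12[F^2]_{y^iy^j}$, the distortion is $$\tau(x,y)=\ln\frac{\sqrt{\det(g_{pq}(x,y))}}{\sigma(x)},\qquad \sigma(x)=\frac{\mathrm{Vol}(B^n)}{\mathrm{Vol}\{(y^i)\in\mathbb R^n: F(x,y^i\partial_{x^i})<1\}},$$ and the $S$-curvature $S(x,y)$, $y\neq0$, is the derivative at $t=0$ of $\tau(\gamma(t),\dot\gamma(t))$, where $\gamma$ is the geodesic of $F$ with $\gamma(0)=x$, $\dot\gamma(0)=y$. Geodesics are the curves whose velocity is an integral curve of the spray $y^i\partial_{x^i}-\frac12 g^{il}\big([F^2]_{x^jy^l}y^j-[F^2]_{x^l}\big)\partial_{y^i}$.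 Then for every nonzero $y\in\mathfrak m=T_xM$ (and every basis of $\mathfrak m$) $S(x,y)$ exists and $$S(x,y)=\big\langle\,[\,y,\nabla^{g_{ij}}\ln\sqrt{\det(g_{pq})}\,(y)\,]_{\mathfrak m},\;y\,\big\rangle_y .$$ -/

import Mathlib

open scoped Manifold ContDiff Topology

noncomputable section

namespace Finsler

/-! ### Minkowski functions on a real vector space -/

section Minkowski

variable {V ι : Type*} [AddCommGroup V] [Module ℝ V] [Fintype ι] [DecidableEq ι]

/-- The fundamental tensor `g_y(u, v) = ½ ∂_u ∂_v (f²) (y)` of a function `f` on a vector space. -/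
def fundTensor (f : V → ℝ) (y u v : V) : ℝ :=
  (1 / 2) * lineDeriv ℝ (fun z => lineDeriv ℝ (fun w => f w ^ 2) z v) y u

/-- The matrix `g_pq (y)` of the fundamental tensor with respect to a basis. -/
def fundMatrix (f : V → ℝ) (b : Module.Basis ι ℝ V) (y : V) : Matrix ι ι ℝ :=
  Matrix.of fun p q => fundTensor f y (b p) (b q)

/-- `ln √det (g_pq (y))`, with respect to a basis. -/
def logSqrtDet (f : V → ℝ) (b : Module.Basis ι ℝ V) (y : V) : ℝ :=
  Real.log (Real.sqrt (fundMatrix f b y).det)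

/-- The gradient of `ln √det (g_pq)` with respect to the fundamental tensor: the vector
`∑ g^{il} (∂ ln √det (g_pq) / ∂ y^i) b_l` at `y`. -/
def gradLogSqrtDet (f : V → ℝ) (b : Module.Basis ι ℝ V) (y : V) : V :=
  ∑ l, (∑ i, (fundMatrix f b y)⁻¹ i l * lineDeriv ℝ (logSqrtDet f b) y (b i)) • b l

end Minkowski

/-! ### Finsler metrics -/

section Metric

variable {n : ℕ} {M : Type*} [TopologicalSpace M] [ChartedSpace (EuclideanSpace ℝ (Fin n)) M]

/-- `F` is a Finsler metric on `M`. Only the values of `F` at nonzero tangent vectors matter. -/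
structure IsFinslerMetric [IsManifold (𝓡 n) ∞ M] (F : TangentBundle (𝓡 n) M → ℝ) : Prop where
  /-- `F` is smooth on the slit tangent bundle. -/
  smooth : ContMDiffOn (𝓡 n).tangent 𝓘(ℝ, ℝ) ∞ F {v | v.2 ≠ 0}
  /-- `F` is positive on nonzero vectors. -/
  pos : ∀ (p : M) (y : TangentSpace (𝓡 n) p), y ≠ 0 → 0 < F ⟨p, y⟩
  /-- `F` is positively homogeneous of degree one. -/
  homog : ∀ (p : M) (y : TangentSpace (𝓡 n) p), y ≠ 0 → ∀ c : ℝ, 0 < c →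
    F ⟨p, c • y⟩ = c * F ⟨p, y⟩
  /-- The fundamental tensor is positive definite at every nonzero vector. -/
  posDef : ∀ (p : M) (y : TangentSpace (𝓡 n) p), y ≠ 0 → ∀ u : TangentSpace (𝓡 n) p, u ≠ 0 →
    0 < fundTensor (fun w : TangentSpace (𝓡 n) p => F ⟨p, w⟩) y u u

/-! ### Local expressions: the distortion, the geodesic spray and the S-curvature -/

/-- `F` in the local coordinates given by the chart `e`: the value of `F` at
`w^i ∂/∂x^i`, at the point with coordinates `u`. -/
def localMetric (F : TangentBundle (𝓡 n) M → ℝ)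
    (e : OpenPartialHomeomorph M (EuclideanSpace ℝ (Fin n)))
    (u w : EuclideanSpace ℝ (Fin n)) : ℝ :=
  F (tangentMap (𝓡 n) (𝓡 n) e.symm ⟨u, w⟩)

/-- The standard basis of the coordinate space. -/
def stdBasis (n : ℕ) : Module.Basis (Fin n) ℝ (EuclideanSpace ℝ (Fin n)) :=
  (EuclideanSpace.basisFun (Fin n) ℝ).toBasis

/-- The Busemann-Hausdorff density `σ` at the point with coordinates `u`. -/
def busemannHausdorff (L : EuclideanSpace ℝ (Fin n) → EuclideanSpace ℝ (Fin n) → ℝ)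
    (u : EuclideanSpace ℝ (Fin n)) : ℝ :=
  (MeasureTheory.volume (Metric.ball (0 : EuclideanSpace ℝ (Fin n)) 1)).toReal /
    (MeasureTheory.volume {w : EuclideanSpace ℝ (Fin n) | L u w < 1}).toReal

/-- The distortion `τ = ln (√det (g_pq) / σ)` in coordinates. -/
def distortion (L : EuclideanSpace ℝ (Fin n) → EuclideanSpace ℝ (Fin n) → ℝ)
    (u w : EuclideanSpace ℝ (Fin n)) : ℝ :=
  Real.log (Real.sqrt (fundMatrix (L u) (stdBasis n) w).det / busemannHausdorff L u)

/-- The vertical part `- ½ g^{il} ([F²]_{x^j y^l} y^j - [F²]_{x^l}) ∂/∂y^i` of the geodesic spray,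
in coordinates. -/
def sprayVert (L : EuclideanSpace ℝ (Fin n) → EuclideanSpace ℝ (Fin n) → ℝ)
    (u w : EuclideanSpace ℝ (Fin n)) : EuclideanSpace ℝ (Fin n) :=
  ∑ i, (-(1 / 2) * ∑ l, (fundMatrix (L u) (stdBasis n) w)⁻¹ i l *
    ((∑ j, w j * lineDeriv ℝ
        (fun z => lineDeriv ℝ (fun v => L z v ^ 2) w (stdBasis n l)) u (stdBasis n j))
      - lineDeriv ℝ (fun z => L z w ^ 2) u (stdBasis n l))) • stdBasis n i

/-- Near the time `0`, the curve `γ` stays in the domain of the chart `e`, and its velocity lift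
is an integral curve in the slit tangent bundle of the geodesic spray; that is, `γ` is a geodesic
of `F`. -/
def IsGeodesicNear (F : TangentBundle (𝓡 n) M → ℝ)
    (e : OpenPartialHomeomorph M (EuclideanSpace ℝ (Fin n))) (γ : ℝ → M) : Prop :=
  ∀ᶠ t in 𝓝 (0 : ℝ), γ t ∈ e.source ∧ DifferentiableAt ℝ (fun s => e (γ s)) t ∧
    deriv (fun s => e (γ s)) t ≠ 0 ∧
    HasDerivAt (deriv fun s => e (γ s))
      (sprayVert (localMetric F e) (e (γ t)) (deriv (fun s => e (γ s)) t)) t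

/-- `γ` is a geodesic of `F` near the time `0`, with initial velocity `y` at `x`. -/
def IsGeodesicFrom (F : TangentBundle (𝓡 n) M → ℝ)
    (e : OpenPartialHomeomorph M (EuclideanSpace ℝ (Fin n)))
    (x : M) (y : TangentSpace (𝓡 n) x) (γ : ℝ → M) : Prop :=
  IsGeodesicNear F e γ ∧ γ 0 = x ∧
    deriv (fun s => e (γ s)) 0 = mfderiv (𝓡 n) (𝓡 n) e x y

/-- `S(x, y) = s`: in every local coordinate system around `x`, there is a geodesic with initial
vector `y`, and along every such geodesic the distortion has derivative `s` at the time `0`. -/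
def HasSCurvature (F : TangentBundle (𝓡 n) M → ℝ) (x : M) (y : TangentSpace (𝓡 n) x)
    (s : ℝ) : Prop :=
  ∀ e ∈ IsManifold.maximalAtlas (𝓡 n) ∞ M, x ∈ e.source →
    (∃ γ : ℝ → M, IsGeodesicFrom F e x y γ) ∧
    ∀ γ : ℝ → M, IsGeodesicFrom F e x y γ →
      HasDerivAt (fun t => distortion (localMetric F e) (e (γ t)) (deriv (fun r => e (γ r)) t)) s 0

end Metric

/-! ### Homogeneous spaces -/

section Homogeneous

variable {k n : ℕ} {G : Type*} [Group G] [TopologicalSpace G]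
  [ChartedSpace (EuclideanSpace ℝ (Fin k)) G]
  {M : Type*} [TopologicalSpace M] [ChartedSpace (EuclideanSpace ℝ (Fin n)) M] [MulAction G M]

variable (G) in
/-- `G` acts on `M` by isometries of `F`. -/
def ActsByIsometries (F : TangentBundle (𝓡 n) M → ℝ) : Prop :=
  ∀ (g : G) (v : TangentBundle (𝓡 n) M), v.2 ≠ 0 →
    F (tangentMap (𝓡 n) (𝓡 n) (fun p : M => g • p) v) = F v

/-- The Lie algebra of a closed subgroup `H` of `G`, inside the Lie algebra of `G`: the vectors `v`
whose one-parameter subgroup `t ↦ exp (t v)`, the integral curve through `1` of the left invariant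
vector field of `v`, lies in `H`. (These vectors form a linear subspace; the span only records
this in the type.) -/
def subgroupLieAlgebra (H : Subgroup G) : Submodule ℝ (GroupLieAlgebra (𝓡 k) G) :=
  Submodule.span ℝ {v | ∃ γ : ℝ → G, γ 0 = 1 ∧
    IsMIntegralCurve (I := 𝓡 k) γ (mulInvariantVectorField v) ∧ ∀ t, γ t ∈ H}

/-- The value at `x` of the vector field on `M` generated by `v`, i.e. the derivative at `g = 1`
of `g ↦ g • x` in the direction `v`. -/
def fundVector (x : M) (v : GroupLieAlgebra (𝓡 k) G) : TangentSpace (𝓡 n) x :=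
  mfderiv (𝓡 k) (𝓡 n) (fun g : G => g • x) 1 v

/-- The Finsler metric at `x`, seen on a subspace `𝔪` of the Lie algebra of `G` through the
map `𝔪 → T_x M`. -/
def metricOn (F : TangentBundle (𝓡 n) M → ℝ) (x : M)
    (𝔪 : Submodule ℝ (GroupLieAlgebra (𝓡 k) G)) (w : 𝔪) : ℝ :=
  F ⟨x, fundVector x (w : GroupLieAlgebra (𝓡 k) G)⟩

end Homogeneous

end Finsler

end

/-!
Work in a chart `e` of `M` at `x` and in the preferred chart of `G` at `1`. Write `X_v` for the
vector field on `M` generated by `v ∈ 𝔤`, and let `γ` be the geodesic with initial velocity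
`y = X_y (x)`, where `y` also denotes the corresponding element of `𝔪`.

The distortion is invariant under isometries (`distortion_map`): a linear isometry between two
tangent spaces changes `√det g` and the Busemann-Hausdorff density by the same factor. Since `G` is
transitive, `γ` lifts to a curve `g t` in `G` with `γ t = g t • x` and initial velocity `y`
(`exists_lift`), and the inverse of `g t` moves the velocity of `γ` back to a curve `w t` in the
fixed tangent space at `x`, on which the distortion is `ln √det g` up to a constant. Hence the S-curvature is the
derivative of `ln √det g` at `y` in the direction of `w' 0`, which is the vertical vector
`η = (spray at y) - (complete lift of X_y at y)`
(`IsLocalIsometricAction.hasDerivAt_distortion`). No derivative of the density is needed, only that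
the unit balls have positive and finite volume.

The spray is the Euler-Lagrange field of `½ F²` (`IsFinslerOn.fundTensor_sprayVert`) and the
complete lifts of the fields `X_u` annihilate `F²` (`IsLocalIsometricAction.killing`). Together with
`actJac_sub_actJac`, which says that `[X_v, X_u] = -X_[v, u]`, this gives Noether's identity
`g_y (η, X_u) = g_y (X_[y, u], y)` for all `u`
(`IsLocalIsometricAction.fundTensor_sprayVert_sub`). For `u` the gradient of `ln √det g`, the left
side is the derivative of `ln √det g` along `η` (`IsMinkowski.fundTensor_gradLogSqrtDet`), and the
right side is the asserted formula.

Finally, `v ↦ X_v (x)` identifies `𝔪` with the tangent space and kills the isotropy algebra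
(`exists_linearEquiv_complement`). It is onto because the orbit map is open, by a Baire category
argument, and of constant rank (`surjective_fderiv_of_finrank_le`, `surjective_actVec`). Its kernel
is the isotropy algebra because the orbit of `x` under the one-parameter subgroup of a vector in the
kernel is an integral curve of the zero field (`mem_subgroupLieAlgebra_stabilizer_iff`).
-/

noncomputable section

namespace Finsler

/-! ### Change of variables in the fundamental tensor -/

section

lemma two_le_infty : (2 : ℕ∞ω) ≤ ∞ := WithTop.coe_le_coe.2 (le_top : (2 : ℕ∞) ≤ ⊤)

section Algebraic
variable {V W ι : Type*} [AddCommGroup V] [Module ℝ V] [AddCommGroup W] [Module ℝ W]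

lemma lineDeriv_comp_linearMap (f : V → ℝ) (T : W →ₗ[ℝ] V) (y v : W) :
    lineDeriv ℝ (fun w => f (T w)) y v = lineDeriv ℝ f (T y) (T v) := by
  simp [lineDeriv]

lemma fundTensor_comp_linearMap (f : V → ℝ) (T : W →ₗ[ℝ] V) (y u v : W) :
    fundTensor (fun w => f (T w)) y u v = fundTensor f (T y) (T u) (T v) := by
  unfold fundTensor
  rw [← lineDeriv_comp_linearMap (fun z => lineDeriv ℝ (fun w => f w ^ 2) z (T v)) T]
  simp_rw [← lineDeriv_comp_linearMap (fun w => f w ^ 2) T]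

lemma fundMatrix_comp_linearEquiv (f : V → ℝ) (T : W ≃ₗ[ℝ] V) (b : Module.Basis ι ℝ W) (y : W) :
    fundMatrix (fun w => f (T w)) b y = fundMatrix f (b.map T) (T y) := by
  ext p q
  simpa [fundMatrix] using fundTensor_comp_linearMap f T.toLinearMap y (b p) (b q)

variable [Fintype ι] [DecidableEq ι]

lemma logSqrtDet_comp_linearEquiv (f : V → ℝ) (T : W ≃ₗ[ℝ] V) (b : Module.Basis ι ℝ W) (y : W) :
    logSqrtDet (fun w => f (T w)) b y = logSqrtDet f (b.map T) (T y) := by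
  simp [logSqrtDet, fundMatrix_comp_linearEquiv]

lemma gradLogSqrtDet_comp_linearEquiv (f : V → ℝ) (T : W ≃ₗ[ℝ] V) (b : Module.Basis ι ℝ W)
    (y : W) :
    T (gradLogSqrtDet (fun w => f (T w)) b y) = gradLogSqrtDet f (b.map T) (T y) := by
  have h : logSqrtDet (fun w => f (T w)) b = fun w => logSqrtDet f (b.map T) (T w) :=
    funext fun w => logSqrtDet_comp_linearEquiv f T b w
  have h' : ∀ i, lineDeriv ℝ (logSqrtDet (fun w => f (T w)) b) y (b i) =
      lineDeriv ℝ (logSqrtDet f (b.map T)) (T y) (T (b i)) := fun i => by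
    rw [h]
    exact lineDeriv_comp_linearMap (logSqrtDet f (b.map T)) T.toLinearMap y (b i)
  simp [gradLogSqrtDet, fundMatrix_comp_linearEquiv, h']

end Algebraic

/-! ### Minkowski norms -/

section MatrixSmooth
variable {X ι : Type*} [NormedAddCommGroup X] [NormedSpace ℝ X] [Fintype ι] [DecidableEq ι]
  {A : X → Matrix ι ι ℝ} {p : X} {r : ℕ∞ω}

lemma contDiffAt_matrix_det (hA : ∀ i j, ContDiffAt ℝ r (fun q => A q i j) p) :
    ContDiffAt ℝ r (fun q => (A q).det) p := by
  simp only [Matrix.det_apply]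
  exact ContDiffAt.sum fun σ _ => (contDiffAt_prod fun i _ => hA _ _).const_smul _

lemma contDiffAt_matrix_inv (hA : ∀ i j, ContDiffAt ℝ r (fun q => A q i j) p)
    (h0 : (A p).det ≠ 0) (i j : ι) : ContDiffAt ℝ r (fun q => (A q)⁻¹ i j) p := by
  simp only [Matrix.inv_def, Ring.inverse_eq_inv', Matrix.smul_apply, Matrix.adjugate_apply,
    smul_eq_mul]
  refine ((contDiffAt_matrix_det hA).inv h0).mul (contDiffAt_matrix_det fun a b => ?_)
  by_cases h : a = j
  · subst h
    simpa using contDiffAt_const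
  · simpa [Matrix.updateRow_ne h] using hA a b

end MatrixSmooth

variable {V ι : Type*} [NormedAddCommGroup V] [NormedSpace ℝ V]

lemma fundTensor_congr {f f' : V → ℝ} {y : V} (h : f =ᶠ[𝓝 y] f') (u v : V) :
    fundTensor f y u v = fundTensor f' y u v := by
  unfold fundTensor
  congr 1
  apply Filter.EventuallyEq.lineDeriv_eq
  filter_upwards [h.eventuallyEq_nhds] with z hz
  apply Filter.EventuallyEq.lineDeriv_eq
  filter_upwards [hz] with w hw
  rw [hw]

lemma lineDeriv_lineDeriv_eq {E : V → ℝ} {y : V} (h : ContDiffAt ℝ 2 E y) (u v : V) :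
    lineDeriv ℝ (fun z => lineDeriv ℝ E z v) y u = fderiv ℝ (fderiv ℝ E) y u v := by
  have h1 : (fun z => lineDeriv ℝ E z v) =ᶠ[𝓝 y] fun z => fderiv ℝ E z v := by
    filter_upwards [h.eventually (by simp)] with z hz
    exact (hz.differentiableAt (by simp)).lineDeriv_eq_fderiv
  have h2 : DifferentiableAt ℝ (fderiv ℝ E) y :=
    (h.fderiv_right (m := 1) (by norm_num)).differentiableAt (by simp)
  rw [h1.lineDeriv_eq, (h2.clm_apply (differentiableAt_const v)).lineDeriv_eq_fderiv,
    fderiv_clm_apply h2 (differentiableAt_const v)]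
  simp

lemma sum_repr_mul_apply [Fintype ι] {b : Module.Basis ι ℝ V} (l : V →L[ℝ] ℝ) (u : V) :
    l u = ∑ i, b.repr u i * l (b i) := by
  calc l u = l (∑ i, b.repr u i • b i) := by rw [b.sum_repr]
    _ = _ := by simp only [map_sum, map_smul, smul_eq_mul]

/-- A (not necessarily reversible) Minkowski norm on a normed space `V`; its value at `0` is
irrelevant. -/
structure IsMinkowski (f : V → ℝ) : Prop where
  smooth : ContDiffOn ℝ ∞ f {0}ᶜ
  pos : ∀ y, y ≠ 0 → 0 < f y
  homog : ∀ y, y ≠ 0 → ∀ c : ℝ, 0 < c → f (c • y) = c * f y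
  posDef : ∀ y, y ≠ 0 → ∀ u, u ≠ 0 → 0 < fundTensor f y u u

namespace IsMinkowski
variable {f : V → ℝ} (hf : IsMinkowski f) {y : V} (hy : y ≠ 0)
include hf hy

lemma contDiffAt_sq : ContDiffAt ℝ ∞ (fun w => f w ^ 2) y :=
  (hf.smooth.contDiffAt (isOpen_compl_singleton.mem_nhds hy)).pow 2

lemma fundTensor_eq (u v : V) :
    fundTensor f y u v = (1 / 2) * fderiv ℝ (fderiv ℝ fun w => f w ^ 2) y u v := by
  rw [fundTensor, lineDeriv_lineDeriv_eq ((hf.contDiffAt_sq hy).of_le two_le_infty)]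

lemma fundTensor_symm (u v : V) : fundTensor f y u v = fundTensor f y v u := by
  rw [hf.fundTensor_eq hy, hf.fundTensor_eq hy]
  congr 1
  exact (hf.contDiffAt_sq hy).isSymmSndFDerivAt (by simpa using two_le_infty) u v

/-- Euler's relation: `∂_v (½ f²) (y) = g_y (v, y)`. -/
lemma fundTensor_self_right (v : V) :
    fundTensor f y v y = (1 / 2) * fderiv ℝ (fun w => f w ^ 2) y v := by
  rw [hf.fundTensor_symm hy, hf.fundTensor_eq hy]
  congr 1
  set E : V → ℝ := fun w => f w ^ 2
  have hd : DifferentiableAt ℝ (fderiv ℝ E) y :=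
    ((hf.contDiffAt_sq hy).fderiv_right (m := 1) (by
      simpa [one_add_one_eq_two] using two_le_infty)).differentiableAt (by simp)
  -- the differential of `f ^ 2` is homogeneous of degree one
  have hE : ∀ c : ℝ, 0 < c → fderiv ℝ E (c • y) v = c * fderiv ℝ E y v := by
    intro c hc
    have h1 : (fun w => E (c • w)) =ᶠ[𝓝 y] fun w => c ^ 2 * E w := by
      filter_upwards [isOpen_compl_singleton.mem_nhds hy] with w hw
      simp only [E]
      rw [hf.homog w hw c hc]
      ring
    have hcy : c • y ≠ 0 := smul_ne_zero hc.ne' hy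
    have hEy : DifferentiableAt ℝ E y := (hf.contDiffAt_sq hy).differentiableAt (by simp)
    have hEc : DifferentiableAt ℝ E (c • y) := (hf.contDiffAt_sq hcy).differentiableAt (by simp)
    have h2 : HasFDerivAt (fun w => E (c • w))
        ((fderiv ℝ E (c • y)).comp (c • ContinuousLinearMap.id ℝ V)) y :=
      HasFDerivAt.comp y hEc.hasFDerivAt ((hasFDerivAt_id y).const_smul c)
    have h3 : HasFDerivAt (fun w => c ^ 2 * E w) (c ^ 2 • fderiv ℝ E y) y :=
      hEy.hasFDerivAt.const_mul (c ^ 2)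
    have h4 := h2.unique (h3.congr_of_eventuallyEq h1)
    have h5 := congrArg (fun T => T v) h4
    simp at h5
    have : c * fderiv ℝ E (c • y) v = c * (c * fderiv ℝ E y v) := by rw [h5]; ring
    exact mul_left_cancel₀ hc.ne' this
  -- its derivative along the ray through `y`, computed in two ways
  have h6 : HasDerivAt (fun c : ℝ => fderiv ℝ E (c • y) v) (fderiv ℝ (fderiv ℝ E) y y v) 1 := by
    have hg : HasDerivAt (fun c : ℝ => c • y) y 1 := by
      simpa using (hasDerivAt_id (1 : ℝ)).smul_const y
    have hd' : HasFDerivAt (fderiv ℝ E) (fderiv ℝ (fderiv ℝ E) y) ((1 : ℝ) • y) := by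
      simpa using hd.hasFDerivAt
    exact (ContinuousLinearMap.apply ℝ ℝ v).hasFDerivAt.comp_hasDerivAt (1 : ℝ)
      (hd'.comp_hasDerivAt (1 : ℝ) hg)
  have h7 : HasDerivAt (fun c : ℝ => fderiv ℝ E (c • y) v) (fderiv ℝ E y v) 1 := by
    have h8 : HasDerivAt (fun c : ℝ => c * fderiv ℝ E y v) (fderiv ℝ E y v) 1 := by
      simpa using (hasDerivAt_id (1 : ℝ)).mul_const (fderiv ℝ E y v)
    refine h8.congr_of_eventuallyEq ?_
    filter_upwards [lt_mem_nhds (show (0 : ℝ) < 1 by norm_num)] with c hc using hE c hc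
  exact h6.unique h7

/-- The fundamental tensor as a bilinear form. -/
lemma exists_bilin : ∃ B : V →L[ℝ] V →L[ℝ] ℝ, ∀ u v, fundTensor f y u v = B u v :=
  ⟨(1 / 2 : ℝ) • fderiv ℝ (fderiv ℝ fun w => f w ^ 2) y, fun u v => by
    simp [hf.fundTensor_eq hy]⟩

variable [Fintype ι] [DecidableEq ι] (b : Module.Basis ι ℝ V)

omit [DecidableEq ι] in
lemma fundMatrix_posDef : (fundMatrix f b y).PosDef := by
  obtain ⟨B, hB⟩ := hf.exists_bilin hy
  refine Matrix.PosDef.of_dotProduct_mulVec_pos ?_ ?_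
  · ext p q
    simpa [fundMatrix] using hf.fundTensor_symm hy _ _
  · intro x hx
    have h1 : (∑ i, x i • b i) ≠ 0 := fun h => hx (by
      have := Fintype.linearIndependent_iff.1 b.linearIndependent x h
      exact funext this)
    have h2 := hf.posDef y hy _ h1
    rw [hB] at h2
    simp only [map_sum, map_smul, sum_apply, smul_apply,
      smul_eq_mul] at h2
    simp only [dotProduct, Matrix.mulVec, fundMatrix, Matrix.of_apply, hB, Pi.star_apply,
      star_trivial]
    calc 0 < _ := h2
      _ = _ := by
        refine Finset.sum_congr rfl fun i _ => ?_
        congr 1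
        refine Finset.sum_congr rfl fun j _ => ?_
        rw [← hB, hf.fundTensor_symm hy, hB, mul_comm]

lemma det_fundMatrix_pos : 0 < (fundMatrix f b y).det := (hf.fundMatrix_posDef hy b).det_pos

omit [Fintype ι] [DecidableEq ι] in
lemma contDiffAt_fundMatrix (i j : ι) : ContDiffAt ℝ ∞ (fun z => fundMatrix f b z i j) y := by
  have h1 : ContDiffAt ℝ ∞ (fderiv ℝ (fderiv ℝ fun w => f w ^ 2)) y :=
    ((hf.contDiffAt_sq hy).fderiv_right (m := ∞) (by simp)).fderiv_right (by simp)
  have h2 : ContDiffAt ℝ ∞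
      (fun z => (1 / 2) * fderiv ℝ (fderiv ℝ fun w => f w ^ 2) z (b i) (b j)) y :=
    contDiffAt_const.mul ((h1.clm_apply contDiffAt_const).clm_apply contDiffAt_const)
  refine h2.congr_of_eventuallyEq ?_
  filter_upwards [isOpen_compl_singleton.mem_nhds hy] with z hz using hf.fundTensor_eq hz _ _

lemma differentiableAt_logSqrtDet : DifferentiableAt ℝ (logSqrtDet f b) y := by
  have h := (contDiffAt_matrix_det (hf.contDiffAt_fundMatrix hy b)).differentiableAt (by simp)
  have h0 := hf.det_fundMatrix_pos hy b
  exact (h.sqrt h0.ne').log (Real.sqrt_pos.2 h0).ne'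

/-- The gradient of `ln √det g` represents its differential. -/
lemma fundTensor_gradLogSqrtDet (η : V) :
    fundTensor f y η (gradLogSqrtDet f b y) = fderiv ℝ (logSqrtDet f b) y η := by
  obtain ⟨B, hB⟩ := hf.exists_bilin hy
  have hd := hf.differentiableAt_logSqrtDet hy b
  set φ := fderiv ℝ (logSqrtDet f b) y with hφ
  set g := fundMatrix f b y with hg
  have hinv : g⁻¹ * g = 1 := Matrix.nonsing_inv_mul _ (hf.det_fundMatrix_pos hy b).ne'.isUnit
  have hBb : ∀ i l, B (b i) (b l) = g l i := fun i l => by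
    rw [← hB, hf.fundTensor_symm hy]; rfl
  rw [hB, gradLogSqrtDet]
  simp only [map_sum, map_smul, smul_eq_mul, hd.lineDeriv_eq_fderiv, ← hφ, ← hg]
  rw [sum_repr_mul_apply (b := b) φ η]
  have h1 : ∀ l, B η (b l) = ∑ j, b.repr η j * g l j := fun l => by
    have := sum_repr_mul_apply (b := b) (B.flip (b l)) η
    simpa [hBb] using this
  have h2 : ∀ i j, ∑ l, g⁻¹ i l * g l j = if i = j then 1 else 0 := fun i j => by
    rw [← Matrix.mul_apply, hinv, Matrix.one_apply]
  calc ∑ l, (∑ i, g⁻¹ i l * φ (b i)) * B η (b l)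
      = ∑ l, ∑ i, ∑ j, φ (b i) * b.repr η j * (g⁻¹ i l * g l j) := by
        refine Finset.sum_congr rfl fun l _ => ?_
        rw [h1, Finset.sum_mul]
        refine Finset.sum_congr rfl fun i _ => ?_
        rw [Finset.mul_sum]
        exact Finset.sum_congr rfl fun j _ => by ring
    _ = ∑ i, ∑ j, φ (b i) * b.repr η j * ∑ l, g⁻¹ i l * g l j := by
        rw [Finset.sum_comm]
        refine Finset.sum_congr rfl fun i _ => ?_
        rw [Finset.sum_comm]
        exact Finset.sum_congr rfl fun j _ => by rw [Finset.mul_sum]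
    _ = ∑ i, b.repr η i * φ (b i) := by
        refine Finset.sum_congr rfl fun i _ => ?_
        simp_rw [h2]
        simp [mul_comm]

end IsMinkowski

/-! ### Dependence on the basis -/

lemma det_fundMatrix_basis [Fintype ι] [DecidableEq ι] {f : V → ℝ} (hf : IsMinkowski f) {y : V}
    (hy : y ≠ 0) (b b' : Module.Basis ι ℝ V) :
    (fundMatrix f b' y).det = (b.det b') ^ 2 * (fundMatrix f b y).det := by
  obtain ⟨B, hB⟩ := hf.exists_bilin hy
  have h : fundMatrix f b' y = (b.toMatrix b').transpose * fundMatrix f b y * b.toMatrix b' := by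
    ext p q
    simp only [Matrix.mul_apply, Matrix.transpose_apply, fundMatrix, Matrix.of_apply, hB]
    have h1 := sum_repr_mul_apply (b := b) (B (b' p)) (b' q)
    rw [h1]
    refine Finset.sum_congr rfl fun i _ => ?_
    have h2 := sum_repr_mul_apply (b := b) (B.flip (b i)) (b' p)
    simp only [ContinuousLinearMap.flip_apply] at h2
    rw [h2, mul_comm]
    rfl
  rw [h, Matrix.det_mul, Matrix.det_mul, Matrix.det_transpose, Module.Basis.det_apply]
  ring

lemma det_fundMatrix_reindex {ι' : Type*} [Fintype ι] [DecidableEq ι] [Fintype ι']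
    [DecidableEq ι'] (f : V → ℝ) (y : V) (b : Module.Basis ι ℝ V) (e : ι ≃ ι') :
    (fundMatrix f (b.reindex e) y).det = (fundMatrix f b y).det := by
  rw [← Matrix.det_submatrix_equiv_self e]
  congr 1
  ext p q
  simp [fundMatrix]

/-- The differential of `ln √det g` does not depend on the basis: a change of basis adds a constant
to the function. -/
lemma fderiv_logSqrtDet_basis {ι' : Type*} [Fintype ι] [DecidableEq ι] [Fintype ι']
    [DecidableEq ι'] {f : V → ℝ} (hf : IsMinkowski f) {y : V}
    (hy : y ≠ 0) (b : Module.Basis ι ℝ V) (b' : Module.Basis ι' ℝ V) :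
    fderiv ℝ (logSqrtDet f b') y = fderiv ℝ (logSqrtDet f b) y := by
  let e : ι' ≃ ι := b'.indexEquiv b
  have hdet : b.det (b'.reindex e) ≠ 0 := (Module.Basis.isUnit_det b (b'.reindex e)).ne_zero
  have h : logSqrtDet f b' =ᶠ[𝓝 y] fun z => Real.log |b.det (b'.reindex e)| + logSqrtDet f b z := by
    filter_upwards [isOpen_compl_singleton.mem_nhds hy] with z hz
    have h0 := hf.det_fundMatrix_pos hz b
    rw [logSqrtDet, ← det_fundMatrix_reindex f z b' e, det_fundMatrix_basis hf hz b,
      Real.sqrt_mul (sq_nonneg _), Real.sqrt_sq_eq_abs,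
      Real.log_mul (abs_ne_zero.2 hdet) (Real.sqrt_pos.2 h0).ne', logSqrtDet]
  rw [h.fderiv_eq, fderiv_const_add]

end

/-! ### The distortion and linear isometries -/

section

variable {n : ℕ}

open MeasureTheory in
/-- The open unit ball of a Minkowski norm has positive and finite volume, the norm being comparable
with the Euclidean one; so the Busemann-Hausdorff density is not a junk value. -/
lemma IsMinkowski.volume_lt_one_toReal_pos {f : EuclideanSpace ℝ (Fin n) → ℝ}
    (hf : IsMinkowski f) {y : EuclideanSpace ℝ (Fin n)} (hy : y ≠ 0) :
    0 < (volume {w | f w < 1}).toReal := by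
  have : Nontrivial (EuclideanSpace ℝ (Fin n)) := ⟨y, 0, hy⟩
  have hne : (Metric.sphere (0 : EuclideanSpace ℝ (Fin n)) 1).Nonempty :=
    NormedSpace.sphere_nonempty.2 zero_le_one
  have hsub : Metric.sphere (0 : EuclideanSpace ℝ (Fin n)) 1 ⊆ {0}ᶜ := fun w hw h => by
    rw [Set.mem_singleton_iff] at h
    simp [h] at hw
  have hc := hf.smooth.continuousOn.mono hsub
  obtain ⟨p, hp, hpm⟩ := (isCompact_sphere _ _).exists_isMinOn hne hc
  obtain ⟨q, hq, hqm⟩ := (isCompact_sphere _ _).exists_isMaxOn hne hc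
  have hfp : 0 < f p := hf.pos p (hsub hp)
  have hfq : 0 < f q := hf.pos q (hsub hq)
  have key : ∀ w, w ≠ 0 → ‖w‖ * f p ≤ f w ∧ f w ≤ ‖w‖ * f q := fun w hw => by
    have hn : 0 < ‖w‖ := norm_pos_iff.2 hw
    have hs : ‖w‖⁻¹ • w ∈ Metric.sphere (0 : EuclideanSpace ℝ (Fin n)) 1 := by
      simp [norm_smul, hn.ne']
    have h1 : f w = ‖w‖ * f (‖w‖⁻¹ • w) := by
      rw [hf.homog w hw _ (inv_pos.2 hn), mul_inv_cancel_left₀ hn.ne']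
    rw [h1]
    exact ⟨mul_le_mul_of_nonneg_left (hpm hs) hn.le, mul_le_mul_of_nonneg_left (hqm hs) hn.le⟩
  refine ENNReal.toReal_pos ?_ ?_
  · have h1 : Metric.ball (0 : EuclideanSpace ℝ (Fin n)) (f q)⁻¹ \ {0} ⊆ {w | f w < 1} := by
      rintro w ⟨hw, hw0⟩
      have := (key w hw0).2
      rw [mem_ball_zero_iff, lt_inv_comm₀ (norm_pos_iff.2 hw0) hfq, ← one_div,
        lt_div_iff₀ (norm_pos_iff.2 hw0)] at hw
      simp only [Set.mem_ofPred_eq]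
      linarith [mul_comm ‖w‖ (f q)]
    have h2 : volume (Metric.ball (0 : EuclideanSpace ℝ (Fin n)) (f q)⁻¹ \ {0}) ≠ 0 := by
      rw [measure_sdiff_null (measure_singleton _)]
      exact (Metric.measure_ball_pos volume _ (inv_pos.2 hfq)).ne'
    exact fun h => h2 (measure_mono_null h1 h)
  · have h1 : {w | f w < 1} ⊆ Metric.closedBall (0 : EuclideanSpace ℝ (Fin n)) (f p)⁻¹ := by
      intro w hw
      rw [mem_closedBall_zero_iff]
      by_cases hw0 : w = 0
      · simpa [hw0] using hfp.le
      · have := (key w hw0).1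
        rw [← one_div, le_div_iff₀ hfp]
        exact this.trans (le_of_lt hw)
    exact ne_top_of_le_ne_top (measure_closedBall_lt_top).ne (measure_mono h1)

lemma busemannHausdorff_pos {L : EuclideanSpace ℝ (Fin n) → EuclideanSpace ℝ (Fin n) → ℝ}
    {u y : EuclideanSpace ℝ (Fin n)} (hL : IsMinkowski (L u)) (hy : y ≠ 0) :
    0 < busemannHausdorff L u :=
  div_pos (ENNReal.toReal_pos (Metric.measure_ball_pos _ _ one_pos).ne'
    (Metric.isBounded_ball.measure_lt_top).ne) (hL.volume_lt_one_toReal_pos hy)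

/-- On a fixed tangent space, the distortion and `ln √det g` differ by a constant. -/
lemma distortion_eq_logSqrtDet_sub
    {L : EuclideanSpace ℝ (Fin n) → EuclideanSpace ℝ (Fin n) → ℝ}
    {u y : EuclideanSpace ℝ (Fin n)} (hL : IsMinkowski (L u)) (hy : y ≠ 0) :
    distortion L u y = logSqrtDet (L u) (stdBasis n) y - Real.log (busemannHausdorff L u) := by
  rw [distortion, Real.log_div (Real.sqrt_pos.2 (hL.det_fundMatrix_pos hy _)).ne'
    (busemannHausdorff_pos hL hy).ne', logSqrtDet]

open MeasureTheory in
/-- The distortion is invariant under linear isometries between tangent spaces: the factors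
`|det D|` by which `√det g` and `σ` change cancel. -/
lemma distortion_map {L : EuclideanSpace ℝ (Fin n) → EuclideanSpace ℝ (Fin n) → ℝ}
    {u u' : EuclideanSpace ℝ (Fin n)} (hL : IsMinkowski (L u))
    (D : EuclideanSpace ℝ (Fin n) ≃ₗ[ℝ] EuclideanSpace ℝ (Fin n))
    (hD : ∀ w, w ≠ 0 → L u (D w) = L u' w) {y : EuclideanSpace ℝ (Fin n)} (hy : y ≠ 0) :
    distortion L u (D y) = distortion L u' y := by
  have : Nontrivial (EuclideanSpace ℝ (Fin n)) := ⟨y, 0, hy⟩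
  set d := LinearMap.det (D : EuclideanSpace ℝ (Fin n) →ₗ[ℝ] EuclideanSpace ℝ (Fin n)) with hd
  have hd0 : d ≠ 0 := (LinearEquiv.isUnit_det' D).ne_zero
  have hDy : D y ≠ 0 := D.map_ne_zero_iff.2 hy
  have hdet : (fundMatrix (L u') (stdBasis n) y).det =
      d ^ 2 * (fundMatrix (L u) (stdBasis n) (D y)).det := by
    have h1 : fundMatrix (L u') (stdBasis n) y =
        fundMatrix (fun w => L u (D w)) (stdBasis n) y := by
      ext p q
      refine (fundTensor_congr ?_ _ _).symm
      filter_upwards [isOpen_compl_singleton.mem_nhds hy] with w hw using hD w hw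
    rw [h1, fundMatrix_comp_linearEquiv, det_fundMatrix_basis hL hDy (stdBasis n)]
    congr 2
    have := Module.Basis.det_comp (stdBasis n)
      (D : EuclideanSpace ℝ (Fin n) →ₗ[ℝ] EuclideanSpace ℝ (Fin n)) (stdBasis n)
    rw [Module.Basis.det_self, mul_one] at this
    rw [hd, ← this]
    congr 1
  have hvol : (volume {w | L u' w < 1}).toReal = |d|⁻¹ * (volume {w | L u w < 1}).toReal := by
    have h1 : volume {w | L u' w < 1} = volume (D ⁻¹' {w | L u w < 1}) := by
      -- the values at `0` are arbitrary, so the two sets agree only up to `{0}`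
      refine measure_congr ?_
      have h0 : ({0}ᶜ : Set (EuclideanSpace ℝ (Fin n))) ∈ ae volume :=
        compl_mem_ae_iff.2 (measure_singleton _)
      filter_upwards [h0] with w hw
      change (L u' w < 1) = (L u (D w) < 1)
      rw [hD w hw]
    have h2 := Measure.addHaar_preimage_linearMap
      (volume : Measure (EuclideanSpace ℝ (Fin n))) (f := D.toLinearMap) hd0 {w | L u w < 1}
    rw [h1]
    have h3 : (D ⁻¹' {w | L u w < 1}) = (D.toLinearMap ⁻¹' {w | L u w < 1}) := rfl
    rw [h3, h2, ENNReal.toReal_mul, ENNReal.toReal_ofReal (abs_nonneg _), abs_inv]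
  have hd1 : |d| ≠ 0 := abs_ne_zero.2 hd0
  rw [distortion, distortion, hdet, Real.sqrt_mul (sq_nonneg _), Real.sqrt_sq_eq_abs,
    busemannHausdorff, busemannHausdorff, hvol]
  congr 1
  rw [div_div_eq_mul_div, div_div_eq_mul_div]
  field_simp

end

/-! ### The geodesic spray in coordinates -/

section

variable {n : ℕ}

/-- `L` is the coordinate expression over the open set `U` of a Finsler metric. -/
structure IsFinslerOn (L : EuclideanSpace ℝ (Fin n) → EuclideanSpace ℝ (Fin n) → ℝ)
    (U : Set (EuclideanSpace ℝ (Fin n))) : Prop where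
  isOpen : IsOpen U
  smooth : ContDiffOn ℝ ∞ (Function.uncurry L) (U ×ˢ {0}ᶜ)
  minkowski : ∀ u ∈ U, IsMinkowski (L u)

/-- The function `F²` in coordinates. -/
def energy (L : EuclideanSpace ℝ (Fin n) → EuclideanSpace ℝ (Fin n) → ℝ)
    (p : EuclideanSpace ℝ (Fin n) × EuclideanSpace ℝ (Fin n)) : ℝ :=
  L p.1 p.2 ^ 2

namespace IsFinslerOn
variable {L : EuclideanSpace ℝ (Fin n) → EuclideanSpace ℝ (Fin n) → ℝ}
  {U : Set (EuclideanSpace ℝ (Fin n))} (hL : IsFinslerOn L U) {u w : EuclideanSpace ℝ (Fin n)}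
  (hu : u ∈ U) (hw : w ≠ 0)
include hL hu hw

lemma prod_mem_nhds : U ×ˢ {0}ᶜ ∈ 𝓝 (u, w) :=
  (hL.isOpen.prod isOpen_compl_singleton).mem_nhds ⟨hu, hw⟩

lemma contDiffAt_energy : ContDiffAt ℝ ∞ (energy L) (u, w) :=
  (hL.smooth.contDiffAt (hL.prod_mem_nhds hu hw)).pow 2

lemma contDiffAt_fderiv_energy : ContDiffAt ℝ ∞ (fderiv ℝ (energy L)) (u, w) :=
  (hL.contDiffAt_energy hu hw).fderiv_right (by simp)

lemma contDiffAt_fderiv_fderiv_energy :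
    ContDiffAt ℝ ∞ (fderiv ℝ (fderiv ℝ (energy L))) (u, w) :=
  (hL.contDiffAt_fderiv_energy hu hw).fderiv_right (by simp)

lemma fundTensor_eq_energy (a c : EuclideanSpace ℝ (Fin n)) :
    fundTensor (L u) w a c = (1 / 2) * fderiv ℝ (fderiv ℝ (energy L)) (u, w) (0, a) (0, c) := by
  rw [← lineDeriv_lineDeriv_eq ((hL.contDiffAt_energy hu hw).of_le two_le_infty)]
  simp [fundTensor, lineDeriv, energy]

lemma lineDeriv_mixed_eq (a c : EuclideanSpace ℝ (Fin n)) :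
    lineDeriv ℝ (fun z => lineDeriv ℝ (fun v => L z v ^ 2) w a) u c =
      fderiv ℝ (fderiv ℝ (energy L)) (u, w) (c, 0) (0, a) := by
  rw [← lineDeriv_lineDeriv_eq ((hL.contDiffAt_energy hu hw).of_le two_le_infty)]
  simp [lineDeriv, energy]

lemma lineDeriv_base_eq (a : EuclideanSpace ℝ (Fin n)) :
    lineDeriv ℝ (fun z => L z w ^ 2) u a = fderiv ℝ (energy L) (u, w) (a, 0) := by
  rw [← ((hL.contDiffAt_energy hu hw).differentiableAt (by simp)).lineDeriv_eq_fderiv]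
  simp [lineDeriv, energy]

lemma fderiv_sq_eq (a : EuclideanSpace ℝ (Fin n)) :
    fderiv ℝ (fun v => L u v ^ 2) w a = fderiv ℝ (energy L) (u, w) (0, a) := by
  rw [← ((hL.contDiffAt_energy hu hw).differentiableAt (by simp)).lineDeriv_eq_fderiv,
    ← (((hL.minkowski u hu).contDiffAt_sq hw).differentiableAt (by simp)).lineDeriv_eq_fderiv]
  simp [lineDeriv, energy]

/-- The spray written with the Fréchet derivatives of `F²`. -/
lemma sprayVert_eq : sprayVert L u w =
    ∑ i, (-(1 / 2) * ∑ l, (fundMatrix (L u) (stdBasis n) w)⁻¹ i l *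
      (fderiv ℝ (fderiv ℝ (energy L)) (u, w) (w, 0) (0, stdBasis n l)
        - fderiv ℝ (energy L) (u, w) (stdBasis n l, 0))) • stdBasis n i := by
  unfold sprayVert
  refine Finset.sum_congr rfl fun i _ => ?_
  congr 2
  refine Finset.sum_congr rfl fun l _ => ?_
  rw [hL.lineDeriv_base_eq hu hw]
  congr 2
  simp only [hL.lineDeriv_mixed_eq hu hw]
  have h := sum_repr_mul_apply (b := stdBasis n)
    (((fderiv ℝ (fderiv ℝ (energy L)) (u, w)).flip (0, stdBasis n l)).comp
      (ContinuousLinearMap.inl ℝ _ _)) w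
  simp only [ContinuousLinearMap.comp_apply, ContinuousLinearMap.inl_apply,
    ContinuousLinearMap.flip_apply] at h
  rw [h]
  refine Finset.sum_congr rfl fun j _ => ?_
  simp [stdBasis]

/-- The spray is the Euler-Lagrange vector field of `½ F²`. -/
lemma fundTensor_sprayVert (z : EuclideanSpace ℝ (Fin n)) :
    fundTensor (L u) w (sprayVert L u w) z =
      (1 / 2) * (fderiv ℝ (energy L) (u, w) (z, 0)
        - fderiv ℝ (fderiv ℝ (energy L)) (u, w) (w, 0) (0, z)) := by
  have hM := hL.minkowski u hu
  obtain ⟨B, hB⟩ := hM.exists_bilin hw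
  set r : EuclideanSpace ℝ (Fin n) →L[ℝ] ℝ :=
    (fderiv ℝ (fderiv ℝ (energy L)) (u, w) (w, 0)).comp (ContinuousLinearMap.inr ℝ _ _)
      - (fderiv ℝ (energy L) (u, w)).comp (ContinuousLinearMap.inl ℝ _ _) with hr
  set g := fundMatrix (L u) (stdBasis n) w with hg
  have hinv : g * g⁻¹ = 1 := Matrix.mul_nonsing_inv _ (hM.det_fundMatrix_pos hw _).ne'.isUnit
  have hs : sprayVert L u w =
      ∑ i, (-(1 / 2) * ∑ l, g⁻¹ i l * r (stdBasis n l)) • stdBasis n i :=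
    hL.sprayVert_eq hu hw
  have hkey : ∀ m, B (sprayVert L u w) (stdBasis n m) = -(1 / 2) * r (stdBasis n m) := fun m => by
    have hBb : ∀ i, B (stdBasis n i) (stdBasis n m) = g m i := fun i => by
      rw [← hB, hM.fundTensor_symm hw]; rfl
    rw [hs]
    simp only [map_sum, map_smul, sum_apply, smul_apply, smul_eq_mul, hBb]
    have h2 : ∀ l, ∑ i, g m i * g⁻¹ i l = if m = l then 1 else 0 := fun l => by
      rw [← Matrix.mul_apply, hinv, Matrix.one_apply]
    calc ∑ i, -(1 / 2) * (∑ l, g⁻¹ i l * r (stdBasis n l)) * g m i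
        = ∑ i, ∑ l, -(1 / 2) * r (stdBasis n l) * (g m i * g⁻¹ i l) := by
          refine Finset.sum_congr rfl fun i _ => ?_
          rw [Finset.mul_sum, Finset.sum_mul]
          exact Finset.sum_congr rfl fun l _ => by ring
      _ = ∑ l, -(1 / 2) * r (stdBasis n l) * ∑ i, g m i * g⁻¹ i l := by
          rw [Finset.sum_comm]
          exact Finset.sum_congr rfl fun l _ => by rw [Finset.mul_sum]
      _ = _ := by
          simp_rw [h2]
          simp
  have hz : B (sprayVert L u w) z = -(1 / 2) * r z := by
    rw [sum_repr_mul_apply (b := stdBasis n) (B _) z, sum_repr_mul_apply (b := stdBasis n) r z,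
      Finset.mul_sum]
    refine Finset.sum_congr rfl fun m _ => ?_
    rw [hkey]
    ring
  rw [hB, hz, hr]
  simp only [sub_apply, ContinuousLinearMap.comp_apply, ContinuousLinearMap.inl_apply,
    ContinuousLinearMap.inr_apply]
  ring

lemma contDiffAt_sprayVert :
    ContDiffAt ℝ ∞ (fun p : EuclideanSpace ℝ (Fin n) × EuclideanSpace ℝ (Fin n) =>
      sprayVert L p.1 p.2) (u, w) := by
  have h1 : ContDiffAt ℝ ∞ (fun p : EuclideanSpace ℝ (Fin n) × EuclideanSpace ℝ (Fin n) =>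
      ∑ i, (-(1 / 2) * ∑ l, (fundMatrix (L p.1) (stdBasis n) p.2)⁻¹ i l *
      (fderiv ℝ (fderiv ℝ (energy L)) p (p.2, 0) (0, stdBasis n l)
        - fderiv ℝ (energy L) p (stdBasis n l, 0))) • stdBasis n i) (u, w) := by
    have hA : ∀ i j, ContDiffAt ℝ ∞
        (fun p : EuclideanSpace ℝ (Fin n) × EuclideanSpace ℝ (Fin n) =>
          fundMatrix (L p.1) (stdBasis n) p.2 i j) (u, w) := fun i j => by
      have h2 : ContDiffAt ℝ ∞ (fun p => (1 / 2) * fderiv ℝ (fderiv ℝ (energy L)) p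
          (0, stdBasis n i) (0, stdBasis n j)) (u, w) :=
        contDiffAt_const.mul (((hL.contDiffAt_fderiv_fderiv_energy hu hw).clm_apply
          contDiffAt_const).clm_apply contDiffAt_const)
      refine h2.congr_of_eventuallyEq ?_
      filter_upwards [hL.prod_mem_nhds hu hw] with p hp
      exact hL.fundTensor_eq_energy hp.1 hp.2 _ _
    have hinv := contDiffAt_matrix_inv hA ((hL.minkowski u hu).det_fundMatrix_pos hw _).ne'
    refine ContDiffAt.sum fun i _ => ContDiffAt.smul (contDiffAt_const.mul
      (ContDiffAt.sum fun l _ => (hinv i l).mul (ContDiffAt.sub ?_ ?_))) contDiffAt_const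
    · exact ((hL.contDiffAt_fderiv_fderiv_energy hu hw).clm_apply
        (contDiffAt_snd.prodMk contDiffAt_const)).clm_apply contDiffAt_const
    · exact (hL.contDiffAt_fderiv_energy hu hw).clm_apply contDiffAt_const
  refine h1.congr_of_eventuallyEq ?_
  filter_upwards [hL.prod_mem_nhds hu hw] with p hp
  exact hL.sprayVert_eq hp.1 hp.2

/-- Local existence of geodesics in coordinates, by the Picard-Lindelöf theorem. -/
lemma exists_geodesic : ∃ c : ℝ → EuclideanSpace ℝ (Fin n), c 0 = u ∧ deriv c 0 = w ∧
    ∀ᶠ t in 𝓝 (0 : ℝ), c t ∈ U ∧ DifferentiableAt ℝ c t ∧ deriv c t ≠ 0 ∧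
      HasDerivAt (deriv c) (sprayVert L (c t) (deriv c t)) t := by
  have hf : ContDiffAt ℝ 1 (fun p : EuclideanSpace ℝ (Fin n) × EuclideanSpace ℝ (Fin n) =>
      (p.2, sprayVert L p.1 p.2)) (u, w) :=
    (contDiffAt_snd.prodMk (hL.contDiffAt_sprayVert hu hw)).of_le
      (one_le_two.trans two_le_infty)
  obtain ⟨α, hα0, ε, hε, hα⟩ :=
    hf.exists_forall_mem_closedBall_exists_eq_forall_mem_Ioo_hasDerivAt₀ 0
  have hev : ∀ᶠ t in 𝓝 (0 : ℝ), HasDerivAt α ((α t).2, sprayVert L (α t).1 (α t).2) t := by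
    filter_upwards [Ioo_mem_nhds (show (0 : ℝ) - ε < 0 by linarith)
      (show (0 : ℝ) < 0 + ε by linarith)] with t ht using hα t ht
  have h1 : ∀ᶠ t in 𝓝 (0 : ℝ), HasDerivAt (fun s => (α s).1) (α t).2 t :=
    hev.mono fun t ht => (hasFDerivAt_fst (p := α t)).comp_hasDerivAt t ht
  have h2 : ∀ᶠ t in 𝓝 (0 : ℝ), HasDerivAt (fun s => (α s).2) (sprayVert L (α t).1 (α t).2) t :=
    hev.mono fun t ht => (hasFDerivAt_snd (p := α t)).comp_hasDerivAt t ht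
  have hd : ∀ᶠ t in 𝓝 (0 : ℝ), deriv (fun s => (α s).1) t = (α t).2 :=
    h1.mono fun t ht => ht.deriv
  have hmem : ∀ᶠ t in 𝓝 (0 : ℝ), α t ∈ U ×ˢ {0}ᶜ := by
    refine hev.self_of_nhds.continuousAt.eventually_mem ?_
    rw [hα0]
    exact hL.prod_mem_nhds hu hw
  refine ⟨fun s => (α s).1, by simp [hα0], by rw [hd.self_of_nhds, hα0], ?_⟩
  filter_upwards [h1, h2, hd.eventually_nhds, hmem] with t h1 h2 hd hm
  refine ⟨hm.1, h1.differentiableAt, ?_, ?_⟩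
  · rw [hd.self_of_nhds]
    exact hm.2
  · rw [hd.self_of_nhds]
    exact h2.congr_of_eventuallyEq hd

end IsFinslerOn

end

/-! ### Local transformation groups in coordinates -/

section

section Bracket
variable {K V : Type*} [NormedAddCommGroup K] [NormedSpace ℝ K] [NormedAddCommGroup V]
  [NormedSpace ℝ V]

/-- The value at `u` of the vector field generated by `ξ`, for the local action `A` with unit
`a₀`. -/
def actVec (A : K × V → V) (a₀ : K) (u : V) : K →L[ℝ] V :=
  (fderiv ℝ A (a₀, u)).comp (ContinuousLinearMap.inl ℝ K V)

/-- The differential at `u` of the vector field `u ↦ actVec A a₀ u ξ` generated by `ξ`, written as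
a mixed second derivative of `A`. -/
def actJac (A : K × V → V) (a₀ : K) (u : V) (ξ : K) : V →L[ℝ] V :=
  (fderiv ℝ (fderiv ℝ A) (a₀, u) (ξ, 0)).comp (ContinuousLinearMap.inr ℝ K V)

lemma hasFDerivAt_actVec {A : K × V → V} {a₀ : K} {u : V} (hA : DifferentiableAt ℝ A (a₀, u)) :
    HasFDerivAt (fun a => A (a, u)) (actVec A a₀ u) a₀ :=
  HasFDerivAt.comp a₀ hA.hasFDerivAt (hasFDerivAt_prodMk_left a₀ u)

lemma fderiv_inr_of_eq {m : K × V → V} {a₀ : K} {u : V} (hm : DifferentiableAt ℝ m (a₀, u))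
    {f : V → V} {f' : V →L[ℝ] V} (h : ∀ᶠ a in 𝓝 u, m (a₀, a) = f a) (hf : HasFDerivAt f f' u)
    (ξ : V) : fderiv ℝ m (a₀, u) (0, ξ) = f' ξ := by
  have h1 : HasFDerivAt (fun a => m (a₀, a)) ((fderiv ℝ m (a₀, u)).comp
      (ContinuousLinearMap.inr ℝ K V)) u :=
    HasFDerivAt.comp u hm.hasFDerivAt (hasFDerivAt_prodMk_right a₀ u)
  have h2 := h1.unique (hf.congr_of_eventuallyEq h)
  simpa using congrArg (fun T => T ξ) h2

/-- Differentiating `A (m (a, b), u₀) = A (a, A (b, u₀))` in `b` at the unit. -/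
lemma fderiv_act_mul {A : K × V → V} {m : K × K → K} {a₀ : K} {u₀ : V}
    (hA : ContDiffAt ℝ ∞ A (a₀, u₀)) (hm : ContDiffAt ℝ ∞ m (a₀, a₀))
    (hA0 : A (a₀, u₀) = u₀) (hm0 : m (a₀, a₀) = a₀)
    (hAm : ∀ᶠ p in 𝓝 (a₀, a₀), A (m p, u₀) = A (p.1, A (p.2, u₀))) :
    ∀ᶠ a in 𝓝 a₀, ∀ ζ, fderiv ℝ A (m (a, a₀), u₀) (fderiv ℝ m (a, a₀) (0, ζ), 0) =
      fderiv ℝ A (a, u₀) (0, actVec A a₀ u₀ ζ) := by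
  have c1 : Filter.Tendsto (fun a => (a, a₀)) (𝓝 a₀) (𝓝 (a₀, a₀)) :=
    (Continuous.prodMk_left a₀).tendsto' _ _ rfl
  have c2 : Filter.Tendsto (fun a => (a, u₀)) (𝓝 a₀) (𝓝 (a₀, u₀)) :=
    (Continuous.prodMk_left u₀).tendsto' _ _ rfl
  have hAev := (hA.of_le (one_le_two.trans two_le_infty)).eventually (by simp)
  have hmev := (hm.of_le (one_le_two.trans two_le_infty)).eventually (by simp)
  have c3 : Filter.Tendsto (fun a => (m (a, a₀), u₀)) (𝓝 a₀) (𝓝 (a₀, u₀)) := by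
    have : Filter.Tendsto (fun a => m (a, a₀)) (𝓝 a₀) (𝓝 a₀) := by
      have := hm.continuousAt.tendsto.comp c1
      rwa [hm0] at this
    exact (this.prodMk_nhds tendsto_const_nhds)
  filter_upwards [c2.eventually hAev, c1.eventually hmev, c3.eventually hAev,
    c1.eventually hAm.eventually_nhds] with a e1 e2 e3 e4 ζ
  have d1 : HasFDerivAt (fun b => A (m (a, b), u₀))
      ((fderiv ℝ A (m (a, a₀), u₀)).comp ((ContinuousLinearMap.inl ℝ K V).comp
        ((fderiv ℝ m (a, a₀)).comp (ContinuousLinearMap.inr ℝ K K)))) a₀ := by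
    have e2' : HasFDerivAt (fun b => m (a, b))
        ((fderiv ℝ m (a, a₀)).comp (ContinuousLinearMap.inr ℝ K K)) a₀ :=
      HasFDerivAt.comp a₀ (e2.differentiableAt (by simp)).hasFDerivAt
        (hasFDerivAt_prodMk_right a a₀)
    exact HasFDerivAt.comp a₀ (e3.differentiableAt (by simp)).hasFDerivAt
      (HasFDerivAt.comp a₀ (hasFDerivAt_prodMk_left (m (a, a₀)) u₀) e2')
  have d2 : HasFDerivAt (fun b => A (a, A (b, u₀)))
      ((fderiv ℝ A (a, u₀)).comp ((ContinuousLinearMap.inr ℝ K V).comp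
        (actVec A a₀ u₀))) a₀ := by
    have e2' : HasFDerivAt (fun b => A (b, u₀)) (actVec A a₀ u₀) a₀ :=
      HasFDerivAt.comp a₀ (hA.differentiableAt (by simp)).hasFDerivAt
        (hasFDerivAt_prodMk_left a₀ u₀)
    have e1' : HasFDerivAt A (fderiv ℝ A (a, u₀)) (a, A (a₀, u₀)) := by
      rw [hA0]; exact (e1.differentiableAt (by simp)).hasFDerivAt
    exact HasFDerivAt.comp a₀ e1'
      (HasFDerivAt.comp a₀ (hasFDerivAt_prodMk_right a (A (a₀, u₀))) e2')
  have c4 : Filter.Tendsto (fun b => (a, b)) (𝓝 a₀) (𝓝 (a, a₀)) :=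
    (Continuous.prodMk_right a).tendsto' _ _ rfl
  have d3 := d1.unique (d2.congr_of_eventuallyEq (c4.eventually e4))
  simpa using congrArg (fun T => T ζ) d3

/-- For a local left action, the vector fields generated by the Lie algebra satisfy
`[X_v, X_w] = - X_[v, w]`, the bracket of the Lie algebra being that of left invariant fields. -/
lemma actJac_sub_actJac {A : K × V → V} {m : K × K → K} {a₀ : K} {u₀ : V}
    (hA : ContDiffAt ℝ ∞ A (a₀, u₀)) (hm : ContDiffAt ℝ ∞ m (a₀, a₀))
    (hA1 : ∀ᶠ u in 𝓝 u₀, A (a₀, u) = u)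
    (hm1 : ∀ᶠ a in 𝓝 a₀, m (a, a₀) = a) (hm2 : ∀ᶠ a in 𝓝 a₀, m (a₀, a) = a)
    (hAm : ∀ᶠ p in 𝓝 (a₀, a₀), A (m p, u₀) = A (p.1, A (p.2, u₀))) (v w : K) :
    actJac A a₀ u₀ v (actVec A a₀ u₀ w) - actJac A a₀ u₀ w (actVec A a₀ u₀ v) =
      actVec A a₀ u₀ (VectorField.lieBracket ℝ (fun a => fderiv ℝ m (a, a₀) (0, v))
        (fun a => fderiv ℝ m (a, a₀) (0, w)) a₀) := by
  have hA0 : A (a₀, u₀) = u₀ := hA1.self_of_nhds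
  have hm0 : m (a₀, a₀) = a₀ := hm1.self_of_nhds
  set H := fderiv ℝ (fderiv ℝ A) (a₀, u₀) with hH
  set N := fderiv ℝ (fderiv ℝ m) (a₀, a₀) with hN
  have hH' : HasFDerivAt (fderiv ℝ A) H (a₀, u₀) :=
    ((hA.fderiv_right (m := ∞) (by simp)).differentiableAt (by simp)).hasFDerivAt
  have hN' : HasFDerivAt (fderiv ℝ m) N (a₀, a₀) :=
    ((hm.fderiv_right (m := ∞) (by simp)).differentiableAt (by simp)).hasFDerivAt
  have hsymm : ∀ p q, H p q = H q p := fun p q =>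
    hA.isSymmSndFDerivAt (by simpa using two_le_infty) p q
  -- the left invariant vector fields and their derivatives
  have hV : ∀ ξ, HasFDerivAt (fun a => fderiv ℝ m (a, a₀) (0, ξ))
      ((ContinuousLinearMap.apply ℝ K ((0, ξ) : K × K)).comp
        (N.comp (ContinuousLinearMap.inl ℝ K K))) a₀ := fun ξ =>
    (ContinuousLinearMap.apply ℝ K ((0, ξ) : K × K)).hasFDerivAt.comp a₀
      (HasFDerivAt.comp a₀ hN' (hasFDerivAt_prodMk_left a₀ a₀))
  have hV0 : ∀ ξ, fderiv ℝ m (a₀, a₀) (0, ξ) = ξ := fun ξ =>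
    fderiv_inr_of_eq (hm.differentiableAt (by simp)) hm2 (hasFDerivAt_id a₀) ξ
  -- the mixed derivative of `A (m (a, b), u₀) = A (a, A (b, u₀))`
  have hmix : ∀ ξ ζ, H (ξ, 0) (ζ, 0) + actVec A a₀ u₀ (N (ξ, 0) (0, ζ)) =
      H (ξ, 0) (0, actVec A a₀ u₀ ζ) := by
    intro ξ ζ
    have hfirst := fderiv_act_mul hA hm hA0 hm0 hAm
    have hfirst' : (fun a => fderiv ℝ A (a, u₀) (fderiv ℝ m (a, a₀) (0, ζ), 0)) =ᶠ[𝓝 a₀]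
        fun a => fderiv ℝ A (a, u₀) (0, actVec A a₀ u₀ ζ) := by
      filter_upwards [hfirst, hm1] with a h1 h2
      rw [← h1 ζ, h2]
    have hHl : HasFDerivAt (fun a => fderiv ℝ A (a, u₀)) (H.comp (ContinuousLinearMap.inl ℝ K V))
        a₀ := HasFDerivAt.comp a₀ hH' (hasFDerivAt_prodMk_left a₀ u₀)
    have d4 := hHl.clm_apply
      ((ContinuousLinearMap.inl ℝ K V).hasFDerivAt.comp a₀ (hV ζ))
    have d5 := hHl.clm_apply (hasFDerivAt_const ((0, actVec A a₀ u₀ ζ) : K × V) a₀)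
    have d6 := d4.unique (d5.congr_of_eventuallyEq hfirst')
    have d7 := congrArg (fun T => T ξ) d6
    simp [hV0] at d7
    rw [← d7, add_comm]
    rfl
  have hb : VectorField.lieBracket ℝ (fun a => fderiv ℝ m (a, a₀) (0, v))
        (fun a => fderiv ℝ m (a, a₀) (0, w)) a₀ = N (v, 0) (0, w) - N (w, 0) (0, v) := by
    rw [VectorField.lieBracket, (hV v).fderiv, (hV w).fderiv, hV0, hV0]
    simp
  rw [hb, map_sub]
  change H (v, 0) (0, actVec A a₀ u₀ w) - H (w, 0) (0, actVec A a₀ u₀ v) = _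
  rw [← hmix, ← hmix, hsymm (v, 0) (w, 0)]
  abel

/-- A curve through `u₀` lifts through the orbit map `a ↦ A (a, u₀)`, with prescribed initial
velocity in the image of a section `J` of its differential. -/
lemma exists_lift [CompleteSpace V] {A : K × V → V} {a₀ : K} {u₀ : V}
    (hA : ContDiffAt ℝ ∞ A (a₀, u₀)) (hA0 : A (a₀, u₀) = u₀) {c : ℝ → V} {y : V}
    (hc0 : c 0 = u₀) (hc : HasDerivAt c y 0) (J : V →L[ℝ] K)
    (hJ : ∀ z, actVec A a₀ u₀ (J z) = z) :
    ∃ g : ℝ → K, g 0 = a₀ ∧ HasDerivAt g (J y) 0 ∧ ∀ᶠ t in 𝓝 (0 : ℝ), A (g t, u₀) = c t := by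
  have hin : HasStrictFDerivAt (fun z => (a₀ + J z, u₀))
      ((ContinuousLinearMap.inl ℝ K V).comp J) 0 :=
    (J.hasStrictFDerivAt.const_add a₀).prodMk (hasStrictFDerivAt_const u₀ _)
  have hA : HasStrictFDerivAt A (fderiv ℝ A (a₀, u₀)) (a₀ + J 0, u₀) := by
    simpa using hA.hasStrictFDerivAt (by simp)
  have hθ : HasStrictFDerivAt (fun z => A (a₀ + J z, u₀))
      ((ContinuousLinearEquiv.refl ℝ V : V ≃L[ℝ] V) : V →L[ℝ] V) 0 := by
    have h1 := hA.comp (0 : V) hin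
    have h2 : (fderiv ℝ A (a₀, u₀)).comp ((ContinuousLinearMap.inl ℝ K V).comp J) =
        ((ContinuousLinearEquiv.refl ℝ V : V ≃L[ℝ] V) : V →L[ℝ] V) := by
      ext1 z
      exact hJ z
    rwa [h2] at h1
  have hθ0 : A (a₀ + J 0, u₀) = c 0 := by simp [hA0, hc0]
  set ψ := hθ.localInverse _ _ _ with hψ
  have hψ0 : ψ (c 0) = 0 := by
    rw [← hθ0]; exact hθ.localInverse_apply_image
  have hψd := hθ.to_localInverse.hasFDerivAt
  rw [hθ0] at hψd
  have hr := hθ.eventually_right_inverse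
  rw [hθ0] at hr
  have hd : HasDerivAt (fun t => ψ (c t)) y 0 := hψd.comp_hasDerivAt (0 : ℝ) hc
  refine ⟨fun t => a₀ + J (ψ (c t)), by simp [hψ0], ?_, ?_⟩
  · exact (J.hasFDerivAt.comp_hasDerivAt (0 : ℝ) hd).const_add a₀
  · exact hc.continuousAt.eventually hr

/-- The derivative of `D⁻¹ c` at a time where `D` is the identity. `Ring.inverse` spares a proof that
`D` stays invertible. -/
lemma hasDerivAt_ringInverse_apply [CompleteSpace V] {D : ℝ → V →L[ℝ] V} {D' : V →L[ℝ] V}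
    (hD0 : D 0 = 1) (hD : HasDerivAt D D' 0) {c : ℝ → V} {s : V} (hc : HasDerivAt c s 0) :
    HasDerivAt (fun t => Ring.inverse (D t) (c t)) (s - D' (c 0)) 0 := by
  have h1 := hasFDerivAt_ringInverse (𝕜 := ℝ) (1 : (V →L[ℝ] V)ˣ)
  rw [Units.val_one, ← hD0] at h1
  have h3 := (h1.comp_hasDerivAt (0 : ℝ) hD).clm_apply hc
  have h4 : s - D' (c 0) = (-D') (c 0) + s := by simp; abel
  rw [h4]
  simpa [hD0] using h3

lemma eventually_isUnit_of_eq_one [CompleteSpace V] {D : ℝ → V →L[ℝ] V}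
    (hD0 : D 0 = 1) (hD : ContinuousAt D 0) : ∀ᶠ t in 𝓝 (0 : ℝ), IsUnit (D t) :=
  hD.eventually_mem (s := {T | IsUnit T}) (by rw [hD0]; exact Units.isOpen.mem_nhds isUnit_one)

end Bracket

section Invariance
variable {K : Type*} [NormedAddCommGroup K] [NormedSpace ℝ K] {n : ℕ}

/-- `A` is, near the point `(a₀, u₀)`, a local action with unit `a₀` which preserves the
Finsler metric `L`. The law for products is not part of the definition. -/
structure IsLocalIsometricAction
    (L : EuclideanSpace ℝ (Fin n) → EuclideanSpace ℝ (Fin n) → ℝ)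
    (U : Set (EuclideanSpace ℝ (Fin n)))
    (A : K × EuclideanSpace ℝ (Fin n) → EuclideanSpace ℝ (Fin n)) (a₀ : K)
    (u₀ : EuclideanSpace ℝ (Fin n)) : Prop where
  finsler : IsFinslerOn L U
  mem : u₀ ∈ U
  smooth : ContDiffAt ℝ ∞ A (a₀, u₀)
  one_act : ∀ᶠ u in 𝓝 u₀, A (a₀, u) = u
  /-- The differentials of the transformations preserve `L` at the base point. -/
  isometric : ∀ᶠ a in 𝓝 a₀, ∀ w, w ≠ 0 → L (A (a, u₀)) (fderiv ℝ A (a, u₀) (0, w)) = L u₀ w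

namespace IsLocalIsometricAction
variable {L : EuclideanSpace ℝ (Fin n) → EuclideanSpace ℝ (Fin n) → ℝ}
  {U : Set (EuclideanSpace ℝ (Fin n))}
  {A : K × EuclideanSpace ℝ (Fin n) → EuclideanSpace ℝ (Fin n)} {a₀ : K}
  {u₀ : EuclideanSpace ℝ (Fin n)} (h : IsLocalIsometricAction L U A a₀ u₀)
include h

lemma act_one : A (a₀, u₀) = u₀ := h.one_act.self_of_nhds

lemma fderiv_inr (w : EuclideanSpace ℝ (Fin n)) : fderiv ℝ A (a₀, u₀) (0, w) = w :=
  fderiv_inr_of_eq (h.smooth.differentiableAt (by simp)) h.one_act (hasFDerivAt_id u₀) w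

lemma hasFDerivAt_fderiv :
    HasFDerivAt (fderiv ℝ A) (fderiv ℝ (fderiv ℝ A) (a₀, u₀)) (a₀, u₀) :=
  ((h.smooth.fderiv_right (m := ∞) (by simp)).differentiableAt (by simp)).hasFDerivAt

/-- The Killing equation: the complete lift of a generated vector field annihilates `F²`. -/
lemma killing (ξ : K) {w : EuclideanSpace ℝ (Fin n)} (hw : w ≠ 0) :
    fderiv ℝ (energy L) (u₀, w) (actVec A a₀ u₀ ξ, actJac A a₀ u₀ ξ w) = 0 := by
  have h1 : HasFDerivAt (fun a => A (a, u₀)) (actVec A a₀ u₀) a₀ :=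
    HasFDerivAt.comp a₀ (h.smooth.differentiableAt (by simp)).hasFDerivAt
      (hasFDerivAt_prodMk_left a₀ u₀)
  have h2 : HasFDerivAt (fun a => fderiv ℝ A (a, u₀))
      ((fderiv ℝ (fderiv ℝ A) (a₀, u₀)).comp (ContinuousLinearMap.inl ℝ K _)) a₀ :=
    HasFDerivAt.comp a₀ h.hasFDerivAt_fderiv (hasFDerivAt_prodMk_left a₀ u₀)
  have h3 := h2.clm_apply
    (hasFDerivAt_const ((0, w) : K × EuclideanSpace ℝ (Fin n)) a₀)
  have h4 : HasFDerivAt (energy L) (fderiv ℝ (energy L) (u₀, w))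
      (A (a₀, u₀), fderiv ℝ A (a₀, u₀) (0, w)) := by
    rw [h.act_one, h.fderiv_inr]
    exact ((h.finsler.contDiffAt_energy h.mem hw).differentiableAt (by simp)).hasFDerivAt
  have h5 := HasFDerivAt.comp a₀ h4 (h1.prodMk h3)
  have h6 : (energy L ∘ fun a => (A (a, u₀), fderiv ℝ A (a, u₀) (0, w))) =ᶠ[𝓝 a₀]
      fun _ => energy L (u₀, w) := by
    filter_upwards [h.isometric] with a ha
    simp [energy, ha w hw]
  have h7 := h5.unique ((hasFDerivAt_const (energy L (u₀, w)) a₀).congr_of_eventuallyEq h6)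
  simpa [actJac] using congrArg (fun T => T ξ) h7

/-- The Killing equation, differentiated along the fibre. -/
lemma killing_fiber (ξ : K) {w : EuclideanSpace ℝ (Fin n)} (hw : w ≠ 0)
    (z : EuclideanSpace ℝ (Fin n)) :
    fderiv ℝ (fderiv ℝ (energy L)) (u₀, w) (actVec A a₀ u₀ ξ, actJac A a₀ u₀ ξ w) (0, z)
      + fderiv ℝ (energy L) (u₀, w) (0, actJac A a₀ u₀ ξ z) = 0 := by
  have h1 : HasFDerivAt (fun v => fderiv ℝ (energy L) (u₀, v))
      ((fderiv ℝ (fderiv ℝ (energy L)) (u₀, w)).comp (ContinuousLinearMap.inr ℝ _ _)) w :=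
    HasFDerivAt.comp w ((h.finsler.contDiffAt_fderiv_energy h.mem hw).differentiableAt
      (by simp)).hasFDerivAt (hasFDerivAt_prodMk_right u₀ w)
  have h2 : HasFDerivAt (fun v => (actVec A a₀ u₀ ξ, actJac A a₀ u₀ ξ v))
      ((0 : EuclideanSpace ℝ (Fin n) →L[ℝ] EuclideanSpace ℝ (Fin n)).prod
        (actJac A a₀ u₀ ξ)) w :=
    (hasFDerivAt_const _ w).prodMk (actJac A a₀ u₀ ξ).hasFDerivAt
  have h3 := h1.clm_apply h2
  have h4 : (fun v => fderiv ℝ (energy L) (u₀, v)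
      (actVec A a₀ u₀ ξ, actJac A a₀ u₀ ξ v)) =ᶠ[𝓝 w] fun _ => 0 := by
    filter_upwards [isOpen_compl_singleton.mem_nhds hw] with v hv using h.killing ξ hv
  have h5 := h3.unique ((hasFDerivAt_const (0 : ℝ) w).congr_of_eventuallyEq h4)
  have h6 := congrArg (fun T => T z) h5
  have hsymm := (h.finsler.contDiffAt_energy h.mem hw).isSymmSndFDerivAt
    (by simpa using two_le_infty)
  rw [hsymm]
  simp at h6
  linarith

/-- Let `y` be the value at `u₀` of the vector field `X_v` generated by `v`. The vertical vector
`η = sprayVert L u₀ y - (d X_v) y` is the difference of the spray and the complete lift of `X_v`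
at `y`, and it satisfies `g_y (η, X_w) = g_y ((d X_v) X_w - (d X_w) X_v, y)`. This is the
infinitesimal form of Noether's theorem for the conserved momentum `g_y (y, X_w)`. -/
lemma fundTensor_sprayVert_sub {y : EuclideanSpace ℝ (Fin n)} (hy : y ≠ 0) {v : K}
    (hv : actVec A a₀ u₀ v = y) (w : K) :
    fundTensor (L u₀) y (sprayVert L u₀ y - actJac A a₀ u₀ v y) (actVec A a₀ u₀ w) =
      fundTensor (L u₀) y
        (actJac A a₀ u₀ v (actVec A a₀ u₀ w) - actJac A a₀ u₀ w (actVec A a₀ u₀ v)) y := by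
  have hM := h.finsler.minkowski u₀ h.mem
  set z := actVec A a₀ u₀ w with hz
  obtain ⟨B, hB⟩ := hM.exists_bilin hy
  -- Euler-Lagrange for the spray, the Killing equation for `w`, its fibre derivative for `v`, and
  -- Euler's relation combine linearly
  have e1 := h.finsler.fundTensor_sprayVert h.mem hy z
  have e2 := h.finsler.fundTensor_eq_energy h.mem hy (actJac A a₀ u₀ v y) z
  have e3 := h.killing w hy
  have e4 := h.killing_fiber v hy z
  have e5 := hM.fundTensor_self_right hy (actJac A a₀ u₀ v z - actJac A a₀ u₀ w y)
  rw [h.finsler.fderiv_sq_eq h.mem hy] at e5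
  rw [← hz] at e3
  rw [hv] at e4 ⊢
  have s1 : ∀ a b : EuclideanSpace ℝ (Fin n), (a, b) = (a, 0) + (0, b) := fun a b => by simp
  rw [s1 z, map_add] at e3
  rw [s1 y, map_add, add_apply] at e4
  have s2 : ((0 : EuclideanSpace ℝ (Fin n)), actJac A a₀ u₀ v z - actJac A a₀ u₀ w y) =
    (0, actJac A a₀ u₀ v z) - (0, actJac A a₀ u₀ w y) := by simp
  rw [s2, map_sub] at e5
  rw [e5, hB, map_sub, sub_apply, ← hB, ← hB, e1, e2]
  linarith

/-- The derivative of the distortion along a geodesic: moving the velocity back to the initial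
point by the group turns it into a derivative along the fixed tangent space. The section `J` of the
differential of the orbit map exists when the action is transitive. -/
theorem hasDerivAt_distortion {c : ℝ → EuclideanSpace ℝ (Fin n)}
    {y : EuclideanSpace ℝ (Fin n)} (hy : y ≠ 0)
    (hc0 : c 0 = u₀) (hc : HasDerivAt c y 0) (hc1 : deriv c 0 = y)
    (hc2 : HasDerivAt (deriv c) (sprayVert L u₀ y) 0)
    (J : EuclideanSpace ℝ (Fin n) →L[ℝ] K) (hJ : ∀ z, actVec A a₀ u₀ (J z) = z) :
    HasDerivAt (fun t => distortion L (c t) (deriv c t))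
      (fderiv ℝ (logSqrtDet (L u₀) (stdBasis n)) y
        (sprayVert L u₀ y - actJac A a₀ u₀ (J y) y)) 0 := by
  obtain ⟨g, hg0, hg, hgc⟩ := exists_lift h.smooth h.act_one hc0 hc J hJ
  have hM := h.finsler.minkowski u₀ h.mem
  -- the differentials of the transformations `g t`, and the velocity moved back to `u₀`
  set D : ℝ → (EuclideanSpace ℝ (Fin n) →L[ℝ] EuclideanSpace ℝ (Fin n)) := fun t =>
    (fderiv ℝ A (g t, u₀)).comp (ContinuousLinearMap.inr ℝ K _) with hD
  have hD0 : D 0 = 1 := by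
    ext1 w
    simp [hD, hg0, h.fderiv_inr]
  have hDd : HasDerivAt D (actJac A a₀ u₀ (J y)) 0 := by
    have h1 : HasFDerivAt (fderiv ℝ A) (fderiv ℝ (fderiv ℝ A) (a₀, u₀)) (g 0, u₀) := by
      rw [hg0]; exact h.hasFDerivAt_fderiv
    have h2 := h1.comp_hasDerivAt (0 : ℝ) (hg.prodMk (hasDerivAt_const (0 : ℝ) u₀))
    have h3 := h2.clm_comp (hasDerivAt_const (0 : ℝ)
      (ContinuousLinearMap.inr ℝ K (EuclideanSpace ℝ (Fin n))))
    simpa [hD, actJac] using h3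
  have hw : HasDerivAt (fun t => Ring.inverse (D t) (deriv c t))
      (sprayVert L u₀ y - actJac A a₀ u₀ (J y) y) 0 := by
    have h1 := hasDerivAt_ringInverse_apply hD0 hDd hc2
    rwa [hc1] at h1
  have hw0 : Ring.inverse (D 0) (deriv c 0) = y := by simp [hD0, hc1]
  -- on the tangent space at `u₀` the density `σ` is constant
  have hlog : HasDerivAt (fun t => logSqrtDet (L u₀) (stdBasis n) (Ring.inverse (D t) (deriv c t))
      - Real.log (busemannHausdorff L u₀))
      (fderiv ℝ (logSqrtDet (L u₀) (stdBasis n)) y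
        (sprayVert L u₀ y - actJac A a₀ u₀ (J y) y)) 0 := by
    have h1 : HasFDerivAt (logSqrtDet (L u₀) (stdBasis n))
        (fderiv ℝ (logSqrtDet (L u₀) (stdBasis n)) y) (Ring.inverse (D 0) (deriv c 0)) := by
      rw [hw0]; exact (hM.differentiableAt_logSqrtDet hy _).hasFDerivAt
    exact (h1.comp_hasDerivAt (0 : ℝ) hw).sub_const _
  refine hlog.congr_of_eventuallyEq ?_
  have hunit := eventually_isUnit_of_eq_one hD0 hDd.continuousAt
  have hne : ∀ᶠ t in 𝓝 (0 : ℝ), Ring.inverse (D t) (deriv c t) ≠ 0 := by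
    refine hw.continuousAt.eventually_ne ?_
    rw [hw0]; exact hy
  have hiso : ∀ᶠ t in 𝓝 (0 : ℝ), ∀ w, w ≠ 0 →
      L (A (g t, u₀)) (fderiv ℝ A (g t, u₀) (0, w)) = L u₀ w := by
    have : Filter.Tendsto g (𝓝 0) (𝓝 a₀) := hg0 ▸ hg.continuousAt.tendsto
    exact this.eventually h.isometric
  have hU : ∀ᶠ t in 𝓝 (0 : ℝ), c t ∈ U := by
    refine hc.continuousAt.eventually_mem ?_
    rw [hc0]; exact h.finsler.isOpen.mem_nhds h.mem
  filter_upwards [hunit, hne, hiso, hU, hgc] with t h1 h2 h3 h4 h5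
  obtain ⟨e, he⟩ := h1
  have h6 : D t (Ring.inverse (D t) (deriv c t)) = deriv c t := by
    rw [← mul_apply_eq_comp, Ring.mul_inverse_cancel _ ⟨e, he⟩]
    rfl
  rw [← distortion_eq_logSqrtDet_sub hM h2]
  have h7 := distortion_map (u' := u₀) (h.finsler.minkowski (c t) h4)
    (ContinuousLinearEquiv.unitsEquiv ℝ _ e).toLinearEquiv (fun w hw => by
      rw [← h3 w hw, h5, ← show D t w = fderiv ℝ A (g t, u₀) (0, w) by simp [hD], ← he]
      rfl) h2
  have h8 : (ContinuousLinearEquiv.unitsEquiv ℝ _ e).toLinearEquiv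
      (Ring.inverse (D t) (deriv c t)) = D t (Ring.inverse (D t) (deriv c t)) := by
    conv_rhs => rw [← he]
    rw [← he]
    rfl
  rw [← h7, h8, h6]

end IsLocalIsometricAction
end Invariance

end

/-! ### The metric in a chart -/

section

variable {n : ℕ} {M : Type*} [TopologicalSpace M] [ChartedSpace (EuclideanSpace ℝ (Fin n)) M]

section Chart
variable {e : OpenPartialHomeomorph M (EuclideanSpace ℝ (Fin n))}

lemma mdifferentiable_of_mem_maximalAtlas (he : e ∈ IsManifold.maximalAtlas (𝓡 n) ∞ M) :
    e.MDifferentiable (𝓡 n) (𝓡 n) :=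
  ⟨(contMDiffOn_of_mem_maximalAtlas he).mdifferentiableOn (by simp),
    (contMDiffOn_symm_of_mem_maximalAtlas he).mdifferentiableOn (by simp)⟩

lemma tangentBundle_mk_congr {a b : M} (h : a = b) (v : EuclideanSpace ℝ (Fin n)) :
    (⟨a, v⟩ : TangentBundle (𝓡 n) M) = ⟨b, v⟩ := by
  subst h
  rfl

lemma tangentMap_symm_tangentMap (he : e ∈ IsManifold.maximalAtlas (𝓡 n) ∞ M)
    (q : TangentBundle (𝓡 n) M) (hq : q.1 ∈ e.source) :
    tangentMap (𝓡 n) (𝓡 n) e.symm (tangentMap (𝓡 n) (𝓡 n) e q) = q := by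
  have hd := mdifferentiable_of_mem_maximalAtlas he
  rw [← tangentMap_comp_at q (hd.mdifferentiableAt_symm (e.map_source hq))
    (hd.mdifferentiableAt hq)]
  have h : e.symm ∘ e =ᶠ[𝓝 q.1] id := e.eventually_left_inverse hq
  obtain ⟨p, v⟩ := q
  simp only [tangentMap, h.mfderiv_eq, mfderiv_id]
  exact tangentBundle_mk_congr (e.left_inv hq) v

variable [IsManifold (𝓡 n) ∞ M]

lemma contMDiffOn_tangentMap_symm (he : e ∈ IsManifold.maximalAtlas (𝓡 n) ∞ M) :
    ContMDiffOn 𝓘(ℝ, EuclideanSpace ℝ (Fin n) × EuclideanSpace ℝ (Fin n)) (𝓡 n).tangent ∞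
      (fun p : EuclideanSpace ℝ (Fin n) × EuclideanSpace ℝ (Fin n) =>
        tangentMap (𝓡 n) (𝓡 n) e.symm ⟨p.1, p.2⟩) (e.target ×ˢ Set.univ) := by
  have : IsManifold (𝓡 n) 1 M := IsManifold.of_le (n := ∞) (one_le_two.trans two_le_infty)
  have h1 := (contMDiffOn_symm_of_mem_maximalAtlas he).contMDiffOn_tangentMapWithin (m := ∞)
    (by simp) e.open_target.uniqueMDiffOn
  have h2 : ContMDiff 𝓘(ℝ, EuclideanSpace ℝ (Fin n) × EuclideanSpace ℝ (Fin n)) (𝓡 n).tangent ∞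
      (fun p : EuclideanSpace ℝ (Fin n) × EuclideanSpace ℝ (Fin n) =>
        (⟨p.1, p.2⟩ : TangentBundle (𝓡 n) (EuclideanSpace ℝ (Fin n)))) := by
    intro p
    rw [Bundle.contMDiffAt_totalSpace]
    refine ⟨contDiff_fst.contMDiff.contMDiffAt, ?_⟩
    simpa using contDiff_snd.contMDiff.contMDiffAt
  refine (h1.comp h2.contMDiffOn (fun p hp => hp.1)).congr fun p hp => ?_
  rw [Function.comp_apply, tangentMapWithin_eq_tangentMap]
  · exact e.open_target.uniqueMDiffOn _ hp.1
  · exact (mdifferentiable_of_mem_maximalAtlas he).mdifferentiableAt_symm hp.1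

/-- The coordinate expression of a Finsler metric. -/
lemma IsFinslerMetric.isFinslerOn_localMetric {F : TangentBundle (𝓡 n) M → ℝ}
    (hF : IsFinslerMetric F) (he : e ∈ IsManifold.maximalAtlas (𝓡 n) ∞ M) :
    IsFinslerOn (localMetric F e) e.target := by
  have hd := mdifferentiable_of_mem_maximalAtlas he
  have hne : ∀ u ∈ e.target, ∀ w : EuclideanSpace ℝ (Fin n), w ≠ 0 →
      mfderiv (𝓡 n) (𝓡 n) e.symm u w ≠ 0 := fun u hu w hw h0 =>
    hw (hd.symm.mfderiv_injective hu (h0.trans (map_zero _).symm))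
  have hs : ContDiffOn ℝ ∞ (Function.uncurry (localMetric F e)) (e.target ×ˢ {0}ᶜ) := by
    rw [← contMDiffOn_iff_contDiffOn]
    exact hF.smooth.comp ((contMDiffOn_tangentMap_symm he).mono
      (Set.prod_mono_right (Set.subset_univ _))) fun p hp => hne p.1 hp.1 p.2 hp.2
  refine ⟨e.open_target, hs, fun u hu => ⟨?_, ?_, ?_, ?_⟩⟩
  · exact hs.comp (contDiff_prodMk_right u).contDiffOn fun w hw => ⟨hu, hw⟩
  · exact fun w hw => hF.pos _ _ (hne u hu w hw)
  · intro w hw c hc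
    have h1 : mfderiv (𝓡 n) (𝓡 n) e.symm u (c • w) = c • mfderiv (𝓡 n) (𝓡 n) e.symm u w :=
      map_smul (mfderiv (𝓡 n) (𝓡 n) e.symm u) c w
    exact (congrArg (fun v : TangentSpace (𝓡 n) (e.symm u) => F ⟨e.symm u, v⟩) h1).trans
      (hF.homog _ _ (hne u hu w hw) c hc)
  · intro w hw z hz
    have h1 := hF.posDef _ _ (hne u hu w hw) _ (hne u hu z hz)
    have h2 := fundTensor_comp_linearMap
      (fun v : TangentSpace (𝓡 n) (e.symm u) => F ⟨e.symm u, v⟩)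
      (mfderiv (𝓡 n) (𝓡 n) e.symm u).toLinearMap w z z
    exact h2.symm ▸ h1

end Chart

end

/-! ### The group action in coordinates -/

section

variable {k n : ℕ} {G : Type*} [Group G] [TopologicalSpace G]
  [ChartedSpace (EuclideanSpace ℝ (Fin k)) G] [LieGroup (𝓡 k) ∞ G]
  {M : Type*} [TopologicalSpace M] [ChartedSpace (EuclideanSpace ℝ (Fin n)) M]
  [IsManifold (𝓡 n) ∞ M] [MulAction G M] [ContMDiffSMul (𝓡 k) (𝓡 n) ∞ G M]

variable (k G) in
/-- The coordinates of the unit of `G`, in the preferred chart at the unit. -/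
def unitCoord : EuclideanSpace ℝ (Fin k) := extChartAt (𝓡 k) (1 : G) 1

variable (k G) in
/-- The inverse of the preferred chart of `G` at the unit. -/
def unitChartInv (a : EuclideanSpace ℝ (Fin k)) : G := (extChartAt (𝓡 k) (1 : G)).symm a

variable (k G) in
/-- The multiplication of `G` in the preferred chart at the unit. -/
def mulCoord (p : EuclideanSpace ℝ (Fin k) × EuclideanSpace ℝ (Fin k)) :
    EuclideanSpace ℝ (Fin k) :=
  extChartAt (𝓡 k) (1 : G) (unitChartInv k G p.1 * unitChartInv k G p.2)

variable (k G) in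
/-- The action of `G` on `M`, in the preferred chart at the unit of `G` and a chart `e` of `M`. -/
def actCoord (e : OpenPartialHomeomorph M (EuclideanSpace ℝ (Fin n)))
    (p : EuclideanSpace ℝ (Fin k) × EuclideanSpace ℝ (Fin n)) : EuclideanSpace ℝ (Fin n) :=
  e (unitChartInv k G p.1 • e.symm p.2)

omit [LieGroup (𝓡 k) ∞ G] in
@[simp] lemma unitChartInv_unitCoord : unitChartInv k G (unitCoord k G) = 1 :=
  extChartAt_to_inv (I := 𝓡 k) (1 : G)

lemma contMDiffAt_unitChartInv :
    ContMDiffAt (𝓡 k) (𝓡 k) ∞ (unitChartInv k G) (unitCoord k G) :=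
  (contMDiffOn_extChartAt_symm (I := 𝓡 k) (n := ∞) (1 : G)).contMDiffAt
    (extChartAt_target_mem_nhds (1 : G))

omit [LieGroup (𝓡 k) ∞ G] in
lemma contMDiffAt_unitChart : ContMDiffAt (𝓡 k) (𝓡 k) ∞ (extChartAt (𝓡 k) (1 : G)) 1 :=
  contMDiffAt_extChartAt

lemma tendsto_unitChartInv :
    Filter.Tendsto (unitChartInv k G) (𝓝 (unitCoord k G)) (𝓝 1) := by
  have := (contMDiffAt_unitChartInv (k := k) (G := G)).continuousAt.tendsto
  rwa [unitChartInv_unitCoord] at this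

omit [LieGroup (𝓡 k) ∞ G] in
lemma unitChart_unitChartInv :
    ∀ᶠ a in 𝓝 (unitCoord k G), extChartAt (𝓡 k) (1 : G) (unitChartInv k G a) = a := by
  filter_upwards [extChartAt_target_mem_nhds (I := 𝓡 k) (1 : G)] with a ha
  exact (extChartAt (𝓡 k) (1 : G)).right_inv ha

lemma contDiffAt_mulCoord :
    ContDiffAt ℝ ∞ (mulCoord k G) (unitCoord k G, unitCoord k G) := by
  rw [← contMDiffAt_iff_contDiffAt]
  have h1 : ContMDiffAt 𝓘(ℝ, EuclideanSpace ℝ (Fin k) × EuclideanSpace ℝ (Fin k)) (𝓡 k) ∞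
      (fun p : EuclideanSpace ℝ (Fin k) × EuclideanSpace ℝ (Fin k) => unitChartInv k G p.1)
      (unitCoord k G, unitCoord k G) :=
    contMDiffAt_unitChartInv.comp (unitCoord k G, unitCoord k G)
      contDiff_fst.contMDiff.contMDiffAt
  have h2 : ContMDiffAt 𝓘(ℝ, EuclideanSpace ℝ (Fin k) × EuclideanSpace ℝ (Fin k)) (𝓡 k) ∞
      (fun p : EuclideanSpace ℝ (Fin k) × EuclideanSpace ℝ (Fin k) => unitChartInv k G p.2)
      (unitCoord k G, unitCoord k G) :=
    contMDiffAt_unitChartInv.comp (unitCoord k G, unitCoord k G)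
      contDiff_snd.contMDiff.contMDiffAt
  have h3 := h1.mul h2
  refine ContMDiffAt.comp _ ?_ h3
  simpa using contMDiffAt_unitChart

omit [LieGroup (𝓡 k) ∞ G] in
lemma mulCoord_unit_right : ∀ᶠ a in 𝓝 (unitCoord k G), mulCoord k G (a, unitCoord k G) = a := by
  filter_upwards [unitChart_unitChartInv (k := k) (G := G)] with a ha
  simpa [mulCoord] using ha

omit [LieGroup (𝓡 k) ∞ G] in
lemma mulCoord_unit_left : ∀ᶠ a in 𝓝 (unitCoord k G), mulCoord k G (unitCoord k G, a) = a := by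
  filter_upwards [unitChart_unitChartInv (k := k) (G := G)] with a ha
  simpa [mulCoord] using ha

section Act
variable {e : OpenPartialHomeomorph M (EuclideanSpace ℝ (Fin n))}
  (he : e ∈ IsManifold.maximalAtlas (𝓡 n) ∞ M) {x : M} (hx : x ∈ e.source)
include he hx

omit [IsManifold (𝓡 n) ∞ M] in
lemma contMDiffAt_act : ContMDiffAt
    𝓘(ℝ, EuclideanSpace ℝ (Fin k) × EuclideanSpace ℝ (Fin n)) (𝓡 n) ∞
    (fun p : EuclideanSpace ℝ (Fin k) × EuclideanSpace ℝ (Fin n) =>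
      unitChartInv k G p.1 • e.symm p.2) (unitCoord k G, e x) := by
  have h1 : ContMDiffAt 𝓘(ℝ, EuclideanSpace ℝ (Fin k) × EuclideanSpace ℝ (Fin n)) (𝓡 k) ∞
      (fun p : EuclideanSpace ℝ (Fin k) × EuclideanSpace ℝ (Fin n) => unitChartInv k G p.1)
      (unitCoord k G, e x) :=
    contMDiffAt_unitChartInv.comp (unitCoord k G, e x) contDiff_fst.contMDiff.contMDiffAt
  have h2 : ContMDiffAt 𝓘(ℝ, EuclideanSpace ℝ (Fin k) × EuclideanSpace ℝ (Fin n)) (𝓡 n) ∞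
      (fun p : EuclideanSpace ℝ (Fin k) × EuclideanSpace ℝ (Fin n) => e.symm p.2)
      (unitCoord k G, e x) :=
    ContMDiffAt.comp (unitCoord k G, e x)
      (contMDiffAt_symm_of_mem_maximalAtlas he (e.map_source hx))
      contDiff_snd.contMDiff.contMDiffAt
  exact h1.smul h2

omit [IsManifold (𝓡 n) ∞ M] in
lemma contDiffAt_actCoord : ContDiffAt ℝ ∞ (actCoord k G e) (unitCoord k G, e x) := by
  rw [← contMDiffAt_iff_contDiffAt]
  refine ContMDiffAt.comp _ ?_ (contMDiffAt_act he hx)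
  simpa [e.left_inv hx] using contMDiffAt_of_mem_maximalAtlas he hx

omit [ChartedSpace (EuclideanSpace ℝ (Fin n)) M] [IsManifold (𝓡 n) ∞ M] [LieGroup (𝓡 k) ∞ G]
  [ContMDiffSMul (𝓡 k) (𝓡 n) ∞ G M] he in
lemma actCoord_one : ∀ᶠ u in 𝓝 (e x), actCoord k G e (unitCoord k G, u) = u := by
  filter_upwards [e.open_target.mem_nhds (e.map_source hx)] with u hu
  simp [actCoord, e.right_inv hu]

omit [IsManifold (𝓡 n) ∞ M] in
lemma eventually_act_mem : ∀ᶠ p in 𝓝 (unitCoord k G, e x),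
    unitChartInv k G p.1 • e.symm p.2 ∈ e.source := by
  refine (contMDiffAt_act he hx).continuousAt.eventually_mem ?_
  simpa [e.left_inv hx] using e.open_source.mem_nhds hx

omit [IsManifold (𝓡 n) ∞ M] in
lemma actCoord_mulCoord : ∀ᶠ p in 𝓝 (unitCoord k G, unitCoord k G),
    actCoord k G e (mulCoord k G p, e x) =
      actCoord k G e (p.1, actCoord k G e (p.2, e x)) := by
  have h1 : ∀ᶠ p in 𝓝 (unitCoord k G, unitCoord k G),
      unitChartInv k G p.1 * unitChartInv k G p.2 ∈ (extChartAt (𝓡 k) (1 : G)).source := by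
    have : IsTopologicalGroup G := topologicalGroup_of_lieGroup (𝓡 k) ∞
    have h2 : Filter.Tendsto (fun p : EuclideanSpace ℝ (Fin k) × EuclideanSpace ℝ (Fin k) =>
        unitChartInv k G p.1 * unitChartInv k G p.2) (𝓝 (unitCoord k G, unitCoord k G))
        (𝓝 (1 * 1)) := by
      rw [nhds_prod_eq]
      exact (tendsto_unitChartInv.comp Filter.tendsto_fst).mul
        (tendsto_unitChartInv.comp Filter.tendsto_snd)
    rw [mul_one] at h2
    exact h2.eventually (extChartAt_source_mem_nhds (1 : G))
  have h3 : ∀ᶠ p in 𝓝 (unitCoord k G, unitCoord k G),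
      unitChartInv k G p.2 • x ∈ e.source := by
    have h4 : Filter.Tendsto (fun p : EuclideanSpace ℝ (Fin k) × EuclideanSpace ℝ (Fin k) =>
        (p.2, e x)) (𝓝 (unitCoord k G, unitCoord k G)) (𝓝 (unitCoord k G, e x)) :=
      (continuous_snd.prodMk continuous_const).tendsto' _ _ rfl
    filter_upwards [h4.eventually (eventually_act_mem he hx)] with p hp
    simpa [e.left_inv hx] using hp
  filter_upwards [h1, h3] with p hp1 hp3
  have h5 : unitChartInv k G (mulCoord k G p) = unitChartInv k G p.1 * unitChartInv k G p.2 :=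
    (extChartAt (𝓡 k) (1 : G)).left_inv hp1
  simp [actCoord, h5, e.left_inv hx, e.left_inv hp3, mul_smul]

omit [IsManifold (𝓡 n) ∞ M] in
/-- In coordinates, the differentials of the transformations preserve the metric. -/
lemma ActsByIsometries.actCoord {F : TangentBundle (𝓡 n) M → ℝ} (hG : ActsByIsometries G F) :
    ∀ᶠ a in 𝓝 (unitCoord k G), ∀ w, w ≠ 0 →
      localMetric F e (Finsler.actCoord k G e (a, e x))
        (fderiv ℝ (Finsler.actCoord k G e) (a, e x) (0, w)) = localMetric F e (e x) w := by
  have hd := mdifferentiable_of_mem_maximalAtlas he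
  have ht : Filter.Tendsto (fun a => (a, e x)) (𝓝 (unitCoord k G)) (𝓝 (unitCoord k G, e x)) :=
    (Continuous.prodMk_left (e x)).tendsto' _ _ rfl
  have hs := ((contDiffAt_actCoord (k := k) (G := G) he hx).of_le
    (one_le_two.trans two_le_infty)).eventually (by simp)
  filter_upwards [ht.eventually hs, ht.eventually (eventually_act_mem he hx)] with a ha1 ha2 w hw
  set g := unitChartInv k G a with hg
  have hgd : MDifferentiable (𝓡 n) (𝓡 n) (fun p : M => g • p) :=
    (ContMDiffSMul.contMDiff_const_smul (I := 𝓡 k) (n := ∞) g).mdifferentiable (by simp)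
  have hsy := hd.mdifferentiableAt_symm (e.map_source hx)
  have h1 : fderiv ℝ (Finsler.actCoord k G e) (a, e x) (0, w) =
      mfderiv (𝓡 n) (𝓡 n) (e ∘ (fun p : M => g • p) ∘ e.symm) (e x) w := by
    have h2 : HasFDerivAt (fun u => Finsler.actCoord k G e (a, u))
        ((fderiv ℝ (Finsler.actCoord k G e) (a, e x)).comp (ContinuousLinearMap.inr ℝ _ _))
        (e x) :=
      HasFDerivAt.comp (e x) (ha1.differentiableAt (by simp)).hasFDerivAt
        (hasFDerivAt_prodMk_right a (e x))
    have h3 := h2.hasMFDerivAt.mfderiv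
    exact (congrArg (fun T => T w) h3).symm
  have h4 : (⟨Finsler.actCoord k G e (a, e x), mfderiv (𝓡 n) (𝓡 n)
      (e ∘ (fun p : M => g • p) ∘ e.symm) (e x) w⟩ :
        TangentBundle (𝓡 n) (EuclideanSpace ℝ (Fin n))) =
      tangentMap (𝓡 n) (𝓡 n) e (tangentMap (𝓡 n) (𝓡 n) (fun p : M => g • p)
        (tangentMap (𝓡 n) (𝓡 n) e.symm ⟨e x, w⟩)) := by
    rw [← tangentMap_comp_at _ (hgd _) hsy, ← tangentMap_comp_at]
    · rfl
    · exact hd.mdifferentiableAt ha2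
    · exact (hgd _).comp (e x) hsy
  refine (congrArg (fun z => localMetric F e (Finsler.actCoord k G e (a, e x)) z) h1).trans ?_
  refine (congrArg (fun q => F (tangentMap (𝓡 n) (𝓡 n) e.symm q)) h4).trans ?_
  rw [tangentMap_symm_tangentMap he _ ha2]
  exact hG g _ fun h0 => hw (hd.symm.mfderiv_injective (e.map_source hx)
    (h0.trans (map_zero (mfderiv (𝓡 n) (𝓡 n) e.symm (e x))).symm))

lemma isLocalIsometricAction {F : TangentBundle (𝓡 n) M → ℝ} (hF : IsFinslerMetric F)
    (hG : ActsByIsometries G F) :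
    IsLocalIsometricAction (localMetric F e) e.target (actCoord k G e) (unitCoord k G) (e x) :=
  ⟨hF.isFinslerOn_localMetric he, e.map_source hx, contDiffAt_actCoord he hx, actCoord_one hx,
    hG.actCoord he hx⟩

omit [LieGroup (𝓡 k) ∞ G] [IsManifold (𝓡 n) ∞ M] he hx in
lemma contMDiff_orbit (x : M) : ContMDiff (𝓡 k) (𝓡 n) ∞ (fun g : G => g • x) :=
  contMDiff_id.smul contMDiff_const

omit [IsManifold (𝓡 n) ∞ M] in
/-- The fundamental vector at `x` in coordinates. -/
lemma actVec_actCoord (v : GroupLieAlgebra (𝓡 k) G) :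
    actVec (actCoord k G e) (unitCoord k G) (e x) v =
      mfderiv (𝓡 n) (𝓡 n) e x (fundVector x v) := by
  have hd := mdifferentiable_of_mem_maximalAtlas he
  have h1 : HasFDerivAt (fun a => actCoord k G e (a, e x))
      (actVec (actCoord k G e) (unitCoord k G) (e x)) (unitCoord k G) :=
    hasFDerivAt_actVec ((contDiffAt_actCoord he hx).differentiableAt (by simp))
  have ho : MDifferentiableAt (𝓡 k) (𝓡 n) (fun g : G => g • x) 1 :=
    (contMDiff_orbit x).mdifferentiable (by simp) _
  have he1 : MDifferentiableAt (𝓡 n) (𝓡 n) e ((fun g : G => g • x) 1) :=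
    hd.mdifferentiableAt (by simpa using hx)
  have h2 := (he1.comp (1 : G) ho).hasMFDerivAt.2
  have h3 : writtenInExtChartAt (𝓡 k) (𝓡 n) (1 : G) (e ∘ fun g : G => g • x) =
      fun a => actCoord k G e (a, e x) := by
    ext1 a
    change e (unitChartInv k G a • x) = e (unitChartInv k G a • e.symm (e x))
    rw [e.left_inv hx]
  rw [h3] at h2
  have h4 := h1.unique (h2.hasFDerivAt (by simp))
  rw [mfderiv_comp (1 : G) he1 ho] at h4
  have h5 : (mfderiv (𝓡 n) (𝓡 n) e ((1 : G) • x) :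
      EuclideanSpace ℝ (Fin n) →L[ℝ] EuclideanSpace ℝ (Fin n)) = mfderiv (𝓡 n) (𝓡 n) e x := by
    rw [one_smul]
  exact (congrArg (fun T => T v) h4).trans (congrArg (fun T : EuclideanSpace ℝ (Fin n) →L[ℝ]
    EuclideanSpace ℝ (Fin n) => T (mfderiv (𝓡 k) (𝓡 n) (fun g : G => g • x) 1 v)) h5)

end Act

/-- The bracket of the Lie algebra of `G`, in coordinates: near the unit, the left invariant field of
`v` is the derivative of `mulCoord` in the second variable. -/
lemma bracket_eq_lieBracket_mulCoord (v w : GroupLieAlgebra (𝓡 k) G) :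
    ⁅v, w⁆ = VectorField.lieBracket ℝ
      (fun a => fderiv ℝ (mulCoord k G) (a, unitCoord k G) (0, v))
      (fun a => fderiv ℝ (mulCoord k G) (a, unitCoord k G) (0, w)) (unitCoord k G) := by
  have : IsManifold (𝓡 k) 1 G := IsManifold.of_le (n := ∞) (one_le_two.trans two_le_infty)
  have key : ∀ v : GroupLieAlgebra (𝓡 k) G,
      VectorField.mpullbackWithin 𝓘(ℝ, EuclideanSpace ℝ (Fin k)) (𝓡 k)
        (extChartAt (𝓡 k) (1 : G)).symm (mulInvariantVectorField v) (Set.range (𝓡 k))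
        =ᶠ[𝓝 (unitCoord k G)] fun a => fderiv ℝ (mulCoord k G) (a, unitCoord k G) (0, v) := by
    intro v
    have ht : Filter.Tendsto (fun a => (a, unitCoord k G)) (𝓝 (unitCoord k G))
        (𝓝 (unitCoord k G, unitCoord k G)) :=
      (Continuous.prodMk_left (unitCoord k G)).tendsto' _ _ rfl
    have hs := ((contDiffAt_mulCoord (k := k) (G := G)).of_le
      (one_le_two.trans two_le_infty)).eventually (by simp)
    filter_upwards [ht.eventually hs, extChartAt_target_mem_nhds (I := 𝓡 k) (1 : G)] with a ha ht
    set φ := extChartAt (𝓡 k) (1 : G) with hφ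
    have hsrc : φ.symm a ∈ φ.source := φ.map_target ht
    have hsrc' : φ.symm a ∈ (chartAt (EuclideanSpace ℝ (Fin k)) (1 : G)).source := by
      simpa [hφ] using hsrc
    have hinv : (mfderivWithin 𝓘(ℝ, EuclideanSpace ℝ (Fin k)) (𝓡 k) φ.symm
        (Set.range (𝓡 k)) a).inverse = mfderiv (𝓡 k) 𝓘(ℝ, EuclideanSpace ℝ (Fin k)) φ
          (φ.symm a) :=
      ContinuousLinearMap.inverse_eq
        (mfderivWithin_extChartAt_symm_comp_mfderiv_extChartAt ht)
        (mfderiv_extChartAt_comp_mfderivWithin_extChartAt_symm ht)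
    rw [VectorField.mpullbackWithin_apply, hinv, mulInvariantVectorField]
    have hm : MDifferentiableAt (𝓡 k) (𝓡 k) (fun b : G => φ.symm a * b) 1 :=
      (contMDiff_mul_left (n := ∞)).mdifferentiable (by simp) _
    have hφd : MDifferentiableAt (𝓡 k) 𝓘(ℝ, EuclideanSpace ℝ (Fin k)) φ
        (φ.symm a * 1) := by
      rw [mul_one]
      exact mdifferentiableAt_extChartAt hsrc'
    have h1 : HasFDerivAt (fun b => mulCoord k G (a, b))
        ((fderiv ℝ (mulCoord k G) (a, unitCoord k G)).comp (ContinuousLinearMap.inr ℝ _ _))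
        (unitCoord k G) :=
      HasFDerivAt.comp (unitCoord k G) (ha.differentiableAt (by simp)).hasFDerivAt
        (hasFDerivAt_prodMk_right a (unitCoord k G))
    have h2 := (hφd.comp (1 : G) hm).hasMFDerivAt.2
    have h3 : writtenInExtChartAt (𝓡 k) 𝓘(ℝ, EuclideanSpace ℝ (Fin k)) (1 : G)
        (φ ∘ fun b : G => φ.symm a * b) = fun b => mulCoord k G (a, b) := by
      ext1 b
      rfl
    rw [h3] at h2
    have h4 := h1.unique (h2.hasFDerivAt (by simp))
    have h5 := congrArg (fun T => T v) h4
    rw [mfderiv_comp (1 : G) hφd hm] at h5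
    have h6 : (mfderiv (𝓡 k) 𝓘(ℝ, EuclideanSpace ℝ (Fin k)) φ (φ.symm a * 1) :
        EuclideanSpace ℝ (Fin k) →L[ℝ] EuclideanSpace ℝ (Fin k)) =
          mfderiv (𝓡 k) 𝓘(ℝ, EuclideanSpace ℝ (Fin k)) φ (φ.symm a) := by
      rw [mul_one]
    exact (congrArg (fun T : EuclideanSpace ℝ (Fin k) →L[ℝ] EuclideanSpace ℝ (Fin k) =>
      T (mfderiv (𝓡 k) (𝓡 k) (fun b : G => φ.symm a * b) 1 v)) h6).symm.trans h5.symm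
  rw [GroupLieAlgebra.bracket_def, ← VectorField.mlieBracketWithin_univ,
    VectorField.mlieBracketWithin_apply, mfderiv_extChartAt_self]
  refine (congrArg (fun T : EuclideanSpace ℝ (Fin k) →L[ℝ] EuclideanSpace ℝ (Fin k) => T _)
    ContinuousLinearMap.inverse_id).trans ?_
  have hfin : ∀ {P Q P' Q' : EuclideanSpace ℝ (Fin k) → EuclideanSpace ℝ (Fin k)}
      {s : Set (EuclideanSpace ℝ (Fin k))}, s = Set.univ → P =ᶠ[𝓝 (unitCoord k G)] P' →
      Q =ᶠ[𝓝 (unitCoord k G)] Q' → VectorField.lieBracketWithin ℝ P Q s (unitCoord k G) =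
        VectorField.lieBracket ℝ P' Q' (unitCoord k G) := by
    rintro P Q P' Q' s rfl hP hQ
    rw [VectorField.lieBracketWithin_univ]
    exact hP.lieBracket_vectorField_eq hQ
  exact hfin (by simp) (key v) (key w)

end

/-! ### Open maps of constant rank are submersions -/

section

section ConstantRank
variable {K V : Type*} [NormedAddCommGroup K] [InnerProductSpace ℝ K] [FiniteDimensional ℝ K]
  [NormedAddCommGroup V] [InnerProductSpace ℝ V]

open Module in
/-- An open map whose rank is maximal at `a₀` has surjective differential at `a₀`: by the constant
rank theorem, near `f a₀` its image is a graph over the range of the differential. -/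
lemma surjective_fderiv_of_finrank_le {f : K → V} {a₀ : K} (hf : ContDiffAt ℝ 1 f a₀)
    (hrank : ∀ᶠ a in 𝓝 a₀,
      finrank ℝ (fderiv ℝ f a).range ≤ finrank ℝ (fderiv ℝ f a₀).range)
    (hopen : 𝓝 (f a₀) ≤ Filter.map f (𝓝 a₀)) : Function.Surjective (fderiv ℝ f a₀) := by
  set T := fderiv ℝ f a₀ with hT
  set R : Submodule ℝ V := T.range with hR
  set N : Submodule ℝ K := T.ker with hN
  set P : V →L[ℝ] R := R.orthogonalProjectionOnto with hP
  set Q : K →L[ℝ] N := N.orthogonalProjectionOnto with hQ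
  have hPR : ∀ z : R, P z = z := fun z => R.orthogonalProjectionOnto_mem_subspace_eq_self z
  have hPT : ∀ v, ((P (T v) : R) : V) = T v := fun v =>
    congrArg Subtype.val (hPR ⟨T v, LinearMap.mem_range_self _ v⟩)
  -- coordinates in which `P ∘ f` is a projection
  have hinj : Function.Injective ((P.comp T).prod Q) := by
    rw [injective_iff_map_eq_zero]
    intro v hv
    have h1 : P (T v) = 0 := congrArg Prod.fst hv
    have h2 : Q v = 0 := congrArg Prod.snd hv
    have h3 : T v = 0 := by rw [← hPT, h1]; rfl
    have h4 : Q v = ⟨v, h3⟩ := N.orthogonalProjectionOnto_mem_subspace_eq_self ⟨v, h3⟩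
    rw [h4] at h2
    exact congrArg Subtype.val h2
  have hdim : finrank ℝ K = finrank ℝ (R × N) := by
    rw [finrank_prod]
    exact (LinearMap.finrank_range_add_finrank_ker T.toLinearMap).symm
  set Φ' : K ≃L[ℝ] R × N := (LinearEquiv.ofInjectiveOfFinrankEq
    ((P.comp T).prod Q).toLinearMap hinj hdim).toContinuousLinearEquiv with hΦ'
  set Φ : K → R × N := fun a => (P (f a), Q a) with hΦ
  have hΦc : ContDiffAt ℝ 1 Φ a₀ := (P.contDiff.contDiffAt.comp a₀ hf).prodMk Q.contDiff.contDiffAt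
  have hΦd : HasFDerivAt Φ (Φ' : K →L[ℝ] R × N) a₀ := by
    have h1 : HasFDerivAt Φ ((P.comp T).prod Q) a₀ :=
      (P.hasFDerivAt.comp a₀ (hf.differentiableAt (by simp)).hasFDerivAt).prodMk Q.hasFDerivAt
    exact h1
  set ψ := hΦc.localInverse hΦd (by simp) with hψ
  have hψc : ContDiffAt ℝ 1 ψ (Φ a₀) := hΦc.to_localInverse hΦd (by simp)
  have hst : HasStrictFDerivAt Φ (Φ' : K →L[ℝ] R × N) a₀ := hΦc.hasStrictFDerivAt' hΦd (by simp)
  have hl : ∀ᶠ a in 𝓝 a₀, ψ (Φ a) = a := hst.eventually_left_inverse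
  have hr : ∀ᶠ p in 𝓝 (Φ a₀), Φ (ψ p) = p := hst.eventually_right_inverse
  have hψ0 : ψ (Φ a₀) = a₀ := hl.self_of_nhds
  have hψt : Filter.Tendsto ψ (𝓝 (Φ a₀)) (𝓝 a₀) := by
    have := hψc.continuousAt.tendsto
    rwa [hψ0] at this
  -- in these coordinates, `f` does not depend on the second variable
  have hgood : ∀ᶠ p in 𝓝 (Φ a₀), DifferentiableAt ℝ (fun q => f (ψ q)) p ∧
      ∀ β : N, fderiv ℝ (fun q => f (ψ q)) p (0, β) = 0 := by
    filter_upwards [hr.eventually_nhds, hψc.eventually (by simp),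
      hψt.eventually (hf.eventually (by simp)), hψt.eventually hrank] with p h1 h2 h3 h4
    have hd1 := h3.differentiableAt (by simp)
    have hd2 := h2.differentiableAt (by simp)
    have hd := hd1.hasFDerivAt.comp p hd2.hasFDerivAt
    refine ⟨hd.differentiableAt, fun β => ?_⟩
    set D := (fderiv ℝ f (ψ p)).comp (fderiv ℝ ψ p) with hD
    have hfd : fderiv ℝ (fun q => f (ψ q)) p = D := hd.fderiv
    rw [hfd]
    have hPD : ∀ q, P (D q) = q.1 := by
      have h5 : HasFDerivAt (fun q => P (f (ψ q))) (P.comp D) p := P.hasFDerivAt.comp p hd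
      have h6 : (fun q => P (f (ψ q))) =ᶠ[𝓝 p] Prod.fst := h1.mono fun q hq => congrArg Prod.fst hq
      have h7 := h5.unique (hasFDerivAt_fst.congr_of_eventuallyEq h6)
      exact fun q => congrArg (fun S => S q) h7
    have hle : finrank ℝ D.range ≤ finrank ℝ R :=
      (Submodule.finrank_mono (LinearMap.range_comp_le_range _ _)).trans h4
    have hsurj : Function.Surjective (P.toLinearMap.comp D.range.subtype) := fun z =>
      ⟨⟨D (z, 0), LinearMap.mem_range_self _ _⟩, hPD (z, 0)⟩
    have heq : finrank ℝ D.range = finrank ℝ R := le_antisymm hle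
      (LinearMap.finrank_le_finrank_of_surjective hsurj)
    have hi := (LinearMap.injective_iff_surjective_of_finrank_eq_finrank heq).2 hsurj
    have h8 : (⟨D (0, β), LinearMap.mem_range_self _ _⟩ : D.range) = 0 := by
      apply hi
      rw [map_zero]
      exact hPD (0, β)
    exact congrArg Subtype.val h8
  obtain ⟨ε, hε, hball⟩ := Metric.eventually_nhds_iff_ball.1 hgood
  have hindep : ∀ α ∈ Metric.ball (Φ a₀).1 ε, ∀ β ∈ Metric.ball (Φ a₀).2 ε,
      f (ψ (α, β)) = f (ψ (α, (Φ a₀).2)) := by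
    intro α hα β hβ
    have hmem : ∀ β ∈ Metric.ball (Φ a₀).2 ε, (α, β) ∈ Metric.ball (Φ a₀) ε := fun β hβ => by
      rw [← Prod.eta (Φ a₀), ← ball_prod_same]
      exact ⟨hα, hβ⟩
    have hdf : ∀ β ∈ Metric.ball (Φ a₀).2 ε, HasFDerivAt (fun β => f (ψ (α, β)))
        ((fderiv ℝ (fun q => f (ψ q)) (α, β)).comp (ContinuousLinearMap.inr ℝ R N)) β :=
      fun β hβ => HasFDerivAt.comp β (hball _ (hmem β hβ)).1.hasFDerivAt
        (hasFDerivAt_prodMk_right α β)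
    refine Metric.isOpen_ball.is_const_of_fderiv_eq_zero (𝕜 := ℝ)
      (f := fun β => f (ψ (α, β)))
      (convex_ball _ _).isPreconnected
      (fun β hβ => (hdf β hβ).differentiableAt.differentiableWithinAt) (fun β hβ => ?_) hβ
      (Metric.mem_ball_self hε)
    rw [(hdf β hβ).fderiv]
    ext1 z
    exact (hball _ (hmem β hβ)).2 z
  -- hence the points near `f a₀` are determined by their projections to the range
  have hfix : ∀ᶠ a in 𝓝 a₀, f a = f (ψ (P (f a), (Φ a₀).2)) := by
    filter_upwards [hl, hΦc.continuousAt.eventually_mem (Metric.ball_mem_nhds _ hε)] with a h1 h2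
    rw [← Prod.eta (Φ a₀), ← ball_prod_same] at h2
    conv_lhs => rw [← h1]
    exact hindep _ h2.1 _ h2.2
  have hfix' : ∀ᶠ z in 𝓝 (f a₀), z = f (ψ (P z, (Φ a₀).2)) := hopen hfix
  have hker : ∀ v, P v = 0 → v = 0 := by
    intro v hv
    have ht : Filter.Tendsto (fun t : ℝ => f a₀ + t • v) (𝓝[≠] 0) (𝓝 (f a₀)) := by
      have : Continuous fun t : ℝ => f a₀ + t • v := by fun_prop
      exact (this.tendsto' 0 _ (by simp)).mono_left nhdsWithin_le_nhds
    obtain ⟨t, h1, h2⟩ := ((ht.eventually hfix').and self_mem_nhdsWithin).exists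
    have h3 := hfix'.self_of_nhds
    rw [map_add, map_smul, hv, smul_zero, add_zero, ← h3] at h1
    exact (by simpa using h1 : t = 0 ∨ v = 0).resolve_left h2
  intro z
  have h1 : z - P z = 0 := hker _ (by rw [map_sub, hPR, sub_self])
  obtain ⟨v, hv⟩ := (P z).2
  exact ⟨v, by rw [sub_eq_zero.1 h1]; exact hv⟩

end ConstantRank

end

/-! ### The tangent space as a quotient of the Lie algebra -/

section

variable {k n : ℕ} {G : Type*} [Group G] [TopologicalSpace G]
  [ChartedSpace (EuclideanSpace ℝ (Fin k)) G] [LieGroup (𝓡 k) ∞ G]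
  {M : Type*} [TopologicalSpace M] [ChartedSpace (EuclideanSpace ℝ (Fin n)) M]
  [MulAction G M] [ContMDiffSMul (𝓡 k) (𝓡 n) ∞ G M]

/-- Near the unit, the rank of the orbit map is at most its rank at the unit: by equivariance, its
differentials at `g` and at `1` differ by those of the translations by `g` in `G` and in `M`. -/
lemma finrank_fderiv_orbit_le {e : OpenPartialHomeomorph M (EuclideanSpace ℝ (Fin n))}
    (he : e ∈ IsManifold.maximalAtlas (𝓡 n) ∞ M) {x : M} (hx : x ∈ e.source) :
    ∀ᶠ a in 𝓝 (unitCoord k G),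
      Module.finrank ℝ (fderiv ℝ (fun b => actCoord k G e (b, e x)) a).range ≤
        Module.finrank ℝ
          (fderiv ℝ (fun b => actCoord k G e (b, e x)) (unitCoord k G)).range := by
  have hA := contDiffAt_actCoord (k := k) (G := G) he hx
  have hm := contDiffAt_mulCoord (k := k) (G := G)
  have hmul := fderiv_act_mul hA hm (actCoord_one hx).self_of_nhds
    mulCoord_unit_right.self_of_nhds (actCoord_mulCoord he hx)
  have ht : Filter.Tendsto (fun a => (a, e x)) (𝓝 (unitCoord k G)) (𝓝 (unitCoord k G, e x)) :=
    (Continuous.prodMk_left (e x)).tendsto' _ _ rfl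
  have ht' : Filter.Tendsto (fun a => (a, unitCoord k G)) (𝓝 (unitCoord k G))
      (𝓝 (unitCoord k G, unitCoord k G)) :=
    (Continuous.prodMk_left (unitCoord k G)).tendsto' _ _ rfl
  -- the differential of left multiplication stays invertible near the unit
  have hunit : ∀ᶠ a in 𝓝 (unitCoord k G), IsUnit ((fderiv ℝ (mulCoord k G)
      (a, unitCoord k G)).comp (ContinuousLinearMap.inr ℝ _ (EuclideanSpace ℝ (Fin k)))) := by
    have hc : ContinuousAt (fun a => (fderiv ℝ (mulCoord k G)
        (a, unitCoord k G)).comp (ContinuousLinearMap.inr ℝ _ (EuclideanSpace ℝ (Fin k))))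
        (unitCoord k G) := by
      have h1 : ContinuousAt (fderiv ℝ (mulCoord k G)) (unitCoord k G, unitCoord k G) :=
        (hm.fderiv_right (m := ∞) (by simp)).continuousAt
      have h2 : ContinuousAt (fun a => fderiv ℝ (mulCoord k G) (a, unitCoord k G))
          (unitCoord k G) := h1.tendsto.comp ht'
      exact h2.clm_comp continuousAt_const
    refine hc.eventually_mem (s := {T | IsUnit T}) (Units.isOpen.mem_nhds ?_)
    have h1 : (fderiv ℝ (mulCoord k G) (unitCoord k G, unitCoord k G)).comp
        (ContinuousLinearMap.inr ℝ _ (EuclideanSpace ℝ (Fin k))) = 1 := by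
      ext1 ζ
      exact fderiv_inr_of_eq (hm.differentiableAt (by simp)) mulCoord_unit_left
        (hasFDerivAt_id (unitCoord k G)) ζ
    rw [h1]
    exact isUnit_one
  have hs := (hA.of_le (one_le_two.trans two_le_infty)).eventually (by simp)
  filter_upwards [hmul, mulCoord_unit_right, hunit, ht.eventually hs] with a h1 h2 h3 h4
  have h5 := (hasFDerivAt_actVec (h4.differentiableAt (by simp))).fderiv
  have h6 := (hasFDerivAt_actVec (hA.differentiableAt (by simp))).fderiv
  rw [h5, h6]
  have hle : (actVec (actCoord k G e) a (e x)).range ≤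
      (actVec (actCoord k G e) (unitCoord k G) (e x)).range.map
        ((fderiv ℝ (actCoord k G e) (a, e x)).comp
          (ContinuousLinearMap.inr ℝ _ (EuclideanSpace ℝ (Fin n)))).toLinearMap := by
    rintro _ ⟨ξ, rfl⟩
    obtain ⟨S, hS⟩ := h3
    refine ⟨_, ⟨(S⁻¹ : (EuclideanSpace ℝ (Fin k) →L[ℝ] EuclideanSpace ℝ (Fin k))ˣ).1 ξ, rfl⟩, ?_⟩
    have h7 := h1 ((S⁻¹ : (EuclideanSpace ℝ (Fin k) →L[ℝ] EuclideanSpace ℝ (Fin k))ˣ).1 ξ)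
    have h8 : fderiv ℝ (mulCoord k G) (a, unitCoord k G)
        (0, (S⁻¹ : (EuclideanSpace ℝ (Fin k) →L[ℝ] EuclideanSpace ℝ (Fin k))ˣ).1 ξ) = ξ := by
      have h9 : S.1 (S⁻¹.1 ξ) = ξ := by
        rw [← mul_apply_eq_comp, Units.mul_inv]
        rfl
      rw [hS] at h9
      exact h9
    rw [h8, h2] at h7
    exact h7.symm
  exact (Submodule.finrank_mono hle).trans (Submodule.finrank_map_le _ _)

/-- The orbit map is open. This is where the second countability of `G` enters, through the Baire
category theorem. -/
lemma nhds_le_map_orbit [SecondCountableTopology G] [T2Space M] [MulAction.IsPretransitive G M]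
    {e : OpenPartialHomeomorph M (EuclideanSpace ℝ (Fin n))} {x : M} (hx : x ∈ e.source) :
    𝓝 (e x) ≤ Filter.map (fun a => actCoord k G e (a, e x)) (𝓝 (unitCoord k G)) := by
  have : IsTopologicalGroup G := topologicalGroup_of_lieGroup (𝓡 k) ∞
  have : ContinuousSMul G M := ContMDiffSMul.continuousSMul (I := 𝓡 k) (I' := 𝓡 n) ∞
  have : LocallyCompactSpace G := Manifold.locallyCompact_of_finiteDimensional (𝓡 k)
  have : LocallyCompactSpace M := Manifold.locallyCompact_of_finiteDimensional (𝓡 n)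
  have hopen := isOpenMap_smul_of_sigmaCompact (G := G) x
  have h1 : 𝓝 (1 : G) ≤ Filter.map (unitChartInv k G) (𝓝 (unitCoord k G)) := by
    intro s hs
    have h2 := (contMDiffAt_unitChart (k := k) (G := G)).continuousAt.preimage_mem_nhds hs
    filter_upwards [h2, extChartAt_source_mem_nhds (I := 𝓡 k) (1 : G)] with g hg1 hg2
    have h3 : unitChartInv k G (extChartAt (𝓡 k) (1 : G) g) = g :=
      (extChartAt (𝓡 k) (1 : G)).left_inv hg2
    have h4 : unitChartInv k G (extChartAt (𝓡 k) (1 : G) g) ∈ s := hg1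
    rwa [h3] at h4
  have h2 : 𝓝 x ≤ Filter.map (fun g : G => g • x) (𝓝 1) := by
    simpa using hopen.nhds_le (1 : G)
  calc 𝓝 (e x) = Filter.map e (𝓝 x) := (e.map_nhds_eq hx).symm
    _ ≤ Filter.map e (Filter.map (fun g : G => g • x)
        (Filter.map (unitChartInv k G) (𝓝 (unitCoord k G)))) :=
      Filter.map_mono (h2.trans (Filter.map_mono h1))
    _ = _ := by
      rw [Filter.map_map, Filter.map_map]
      congr 1
      ext1 a
      simp [actCoord, e.left_inv hx]

/-- The orbit map of a transitive action is a submersion, being open and of constant rank. -/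
lemma surjective_actVec [SecondCountableTopology G] [T2Space M] [MulAction.IsPretransitive G M]
    {e : OpenPartialHomeomorph M (EuclideanSpace ℝ (Fin n))}
    (he : e ∈ IsManifold.maximalAtlas (𝓡 n) ∞ M) {x : M} (hx : x ∈ e.source) :
    Function.Surjective (actVec (actCoord k G e) (unitCoord k G) (e x)) := by
  have hA := contDiffAt_actCoord (k := k) (G := G) he hx
  have h1 := (hasFDerivAt_actVec (hA.differentiableAt (by simp))).fderiv
  have h2 : actCoord k G e (unitCoord k G, e x) = e x := (actCoord_one hx).self_of_nhds
  have hf : ContDiffAt ℝ 1 (fun b => actCoord k G e (b, e x)) (unitCoord k G) :=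
    (hA.comp (unitCoord k G) (contDiff_prodMk_left (e x)).contDiffAt).of_le
      (one_le_two.trans two_le_infty)
  have h3 := surjective_fderiv_of_finrank_le hf (finrank_fderiv_orbit_le he hx)
    (by rw [h2]; exact nhds_le_map_orbit hx)
  rwa [h1] at h3

/-! ### One-parameter subgroups and the isotropy algebra -/

lemma mfderiv_mul_left_mulInvariantVectorField (v : GroupLieAlgebra (𝓡 k) G) (g h : G) :
    mfderiv (𝓡 k) (𝓡 k) (fun b => g * b) h (mulInvariantVectorField v h) =
      mulInvariantVectorField v (g * h) := by
  have hd : ∀ a : G, MDifferentiable (𝓡 k) (𝓡 k) (fun b : G => a * b) := fun a =>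
    (contMDiff_mul_left (n := ∞)).mdifferentiable (by simp)
  have h1 : (fun b => g * h * b) = (fun b => g * b) ∘ (fun b => h * b) := by
    ext b; simp [mul_assoc]
  have h2 : (mfderiv (𝓡 k) (𝓡 k) (fun b => g * b) (h * 1) :
      EuclideanSpace ℝ (Fin k) →L[ℝ] EuclideanSpace ℝ (Fin k)) =
        mfderiv (𝓡 k) (𝓡 k) (fun b => g * b) h := by
    rw [mul_one]
  have h3 := congrArg (fun f : G → G => (mfderiv (𝓡 k) (𝓡 k) f 1 :
    EuclideanSpace ℝ (Fin k) →L[ℝ] EuclideanSpace ℝ (Fin k)) v) h1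
  simp only at h3
  rw [mfderiv_comp (1 : G) (hd g _) (hd h _)] at h3
  exact (congrArg (fun T : EuclideanSpace ℝ (Fin k) →L[ℝ] EuclideanSpace ℝ (Fin k) =>
    T (mulInvariantVectorField v h)) h2).symm.trans h3.symm

/-- The orbit map sends the left invariant field of `v`, at `g`, to the translate by `g` of the
fundamental vector of `v` at `x`. -/
lemma mfderiv_orbit_mulInvariantVectorField (x : M) (v : GroupLieAlgebra (𝓡 k) G) (g : G) :
    mfderiv (𝓡 k) (𝓡 n) (fun h : G => h • x) g (mulInvariantVectorField v g) =
      mfderiv (𝓡 n) (𝓡 n) (fun p : M => g • p) x (fundVector x v) := by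
  have ho : MDifferentiable (𝓡 k) (𝓡 n) (fun h : G => h • x) :=
    (contMDiff_orbit x).mdifferentiable (by simp)
  have hl : MDifferentiable (𝓡 k) (𝓡 k) (fun b : G => g * b) :=
    (contMDiff_mul_left (n := ∞)).mdifferentiable (by simp)
  have hg : MDifferentiable (𝓡 n) (𝓡 n) (fun p : M => g • p) :=
    (ContMDiffSMul.contMDiff_const_smul (I := 𝓡 k) (n := ∞) g).mdifferentiable (by simp)
  have h1 : (fun h : G => h • x) ∘ (fun b : G => g * b) =
      (fun p : M => g • p) ∘ (fun h : G => h • x) := by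
    ext b; simp [mul_smul]
  have h2 := congrArg (fun f : G → M => (mfderiv (𝓡 k) (𝓡 n) f 1 :
    EuclideanSpace ℝ (Fin k) →L[ℝ] EuclideanSpace ℝ (Fin n)) v) h1
  simp only at h2
  rw [mfderiv_comp (1 : G) (ho _) (hl _), mfderiv_comp (1 : G) (hg _) (ho _)] at h2
  have h3 : (mfderiv (𝓡 k) (𝓡 n) (fun h : G => h • x) (g * 1) :
      EuclideanSpace ℝ (Fin k) →L[ℝ] EuclideanSpace ℝ (Fin n)) =
        mfderiv (𝓡 k) (𝓡 n) (fun h : G => h • x) g := by rw [mul_one]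
  have h4 : (mfderiv (𝓡 n) (𝓡 n) (fun p : M => g • p) ((1 : G) • x) :
      EuclideanSpace ℝ (Fin n) →L[ℝ] EuclideanSpace ℝ (Fin n)) =
        mfderiv (𝓡 n) (𝓡 n) (fun p : M => g • p) x := by rw [one_smul]
  exact (congrArg (fun T : EuclideanSpace ℝ (Fin k) →L[ℝ] EuclideanSpace ℝ (Fin n) =>
    T (mulInvariantVectorField v g)) h3).symm.trans (h2.trans
      (congrArg (fun T : EuclideanSpace ℝ (Fin n) →L[ℝ] EuclideanSpace ℝ (Fin n) =>
        T (fundVector x v)) h4))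

lemma _root_.ContinuousLinearMap.comp_smulRight_one {E E' : Type*} [AddCommGroup E]
    [Module ℝ E] [TopologicalSpace E] [ContinuousSMul ℝ E] [AddCommGroup E'] [Module ℝ E']
    [TopologicalSpace E'] [ContinuousSMul ℝ E'] (T : E →L[ℝ] E') {w : E} {w' : E'}
    (h : T w = w') :
    T.comp ((1 : ℝ →L[ℝ] ℝ).smulRight w) = (1 : ℝ →L[ℝ] ℝ).smulRight w' := by
  ext1
  simp [h]

/-- Left invariant vector fields are complete: left translates of one local integral curve give
integral curves through all points on a common time interval. -/
lemma exists_oneParameterSubgroup [T2Space G] (v : GroupLieAlgebra (𝓡 k) G) :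
    ∃ γ : ℝ → G, γ 0 = 1 ∧ IsMIntegralCurve (I := 𝓡 k) γ (mulInvariantVectorField v) := by
  have : IsManifold (𝓡 k) 1 G := IsManifold.of_le (n := ∞) (one_le_two.trans two_le_infty)
  have hsm : ContMDiff (𝓡 k) (𝓡 k).tangent 1
      (fun g : G => (⟨g, mulInvariantVectorField v g⟩ : TangentBundle (𝓡 k) G)) := by
    have : LieGroup (𝓡 k) (minSmoothness ℝ 3) G :=
      LieGroup.of_le (n := ∞) (by simp; exact WithTop.coe_le_coe.2 (le_top : (3 : ℕ∞) ≤ ⊤))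
    exact (contMDiff_mulInvariantVectorField v).of_le (by simp)
  obtain ⟨γ, hγ0, hγ⟩ := exists_isMIntegralCurveAt_of_contMDiffAt_boundaryless 0 hsm.contMDiffAt
    (x₀ := (1 : G))
  obtain ⟨ε, hε, hγ⟩ := isMIntegralCurveAt_iff'.1 hγ
  rw [Real.ball_eq_Ioo, zero_sub, zero_add] at hγ
  refine exists_isMIntegralCurve_of_isMIntegralCurveOn hsm hε (fun g => ?_) 1
  refine ⟨fun t => g * γ t, by simp [hγ0], fun t ht => ?_⟩
  have hl : MDifferentiable (𝓡 k) (𝓡 k) (fun b : G => g * b) :=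
    (contMDiff_mul_left (n := ∞)).mdifferentiable (by simp)
  have h1 := (hl (γ t)).hasMFDerivAt.comp_hasMFDerivWithinAt t (hγ t ht)
  exact h1.congr_mfderiv (ContinuousLinearMap.comp_smulRight_one _
    (mfderiv_mul_left_mulInvariantVectorField v g (γ t)))

/-- The Lie algebra of the isotropy group at `x` is the kernel of `v ↦ X_v (x)`. -/
lemma mem_subgroupLieAlgebra_stabilizer_iff [T2Space G] [T2Space M] [IsManifold (𝓡 n) ∞ M]
    (x : M) (v : GroupLieAlgebra (𝓡 k) G) :
    v ∈ subgroupLieAlgebra (MulAction.stabilizer G x) ↔ fundVector (n := n) x v = 0 := by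
  have ho : MDifferentiable (𝓡 k) (𝓡 n) (fun h : G => h • x) :=
    (contMDiff_orbit x).mdifferentiable (by simp)
  constructor
  · let K : Submodule ℝ (GroupLieAlgebra (𝓡 k) G) :=
      LinearMap.ker (mfderiv (𝓡 k) (𝓡 n) (fun g : G => g • x) 1).toLinearMap
    suffices h : subgroupLieAlgebra (MulAction.stabilizer G x) ≤ K from fun hv => h hv
    refine Submodule.span_le.2 ?_
    rintro w ⟨γ, hγ0, hγ, hmem⟩
    have h1 := (ho (γ 0)).hasMFDerivAt.comp (0 : ℝ) (hγ 0)
    have h2 : (fun h : G => h • x) ∘ γ = fun _ => x := funext fun t => hmem t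
    rw [h2] at h1
    have h3 := hasMFDerivAt_unique h1 (hasMFDerivAt_const x (0 : ℝ))
    have h4 := congrArg (fun T : ℝ →L[ℝ] EuclideanSpace ℝ (Fin n) => T 1) h3
    have h5 : mfderiv (𝓡 k) (𝓡 n) (fun h : G => h • x) (γ 0)
        (mulInvariantVectorField w (γ 0)) = 0 := by
      have h6 : ((1 : ℝ →L[ℝ] ℝ).smulRight (mulInvariantVectorField w (γ 0))) 1 =
        mulInvariantVectorField w (γ 0) := by simp
      rw [← h6]
      exact h4
    have h7 : ∀ g : G, g = 1 → mfderiv (𝓡 k) (𝓡 n) (fun h : G => h • x) g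
        (mulInvariantVectorField w g) = 0 → fundVector (n := n) x w = 0 := by
      rintro g rfl hg
      have h8 : mulInvariantVectorField w (1 : G) = w := by
        have h9 : (fun b : G => 1 * b) = id := funext one_mul
        have h10 := congrArg (fun f : G → G => (mfderiv (𝓡 k) (𝓡 k) f 1 :
          EuclideanSpace ℝ (Fin k) →L[ℝ] EuclideanSpace ℝ (Fin k)) w) h9
        exact h10.trans (congrArg (fun T : EuclideanSpace ℝ (Fin k) →L[ℝ]
          EuclideanSpace ℝ (Fin k) => T w) (mfderiv_id (I := 𝓡 k) (x := (1 : G))))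
      rw [h8] at hg
      exact hg
    exact h7 _ hγ0 h5
  · intro hv
    refine Submodule.subset_span ?_
    obtain ⟨γ, hγ0, hγ⟩ := exists_oneParameterSubgroup v
    refine ⟨γ, hγ0, hγ, fun t => ?_⟩
    -- the orbit of `x` under the one-parameter subgroup is an integral curve of the zero field
    have : IsManifold (𝓡 n) 1 M := IsManifold.of_le (n := ∞) (one_le_two.trans two_le_infty)
    have hz : ContMDiff (𝓡 n) (𝓡 n).tangent 1
        (fun p : M => (⟨p, (0 : TangentSpace (𝓡 n) p)⟩ : TangentBundle (𝓡 n) M)) :=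
      Bundle.contMDiff_zeroSection ℝ _
    have h1 : IsMIntegralCurve (I := 𝓡 n) (fun t => γ t • x)
        (fun p => (0 : TangentSpace (𝓡 n) p)) := by
      intro s
      have h2 := (ho (γ s)).hasMFDerivAt.comp s (hγ s)
      have h3 := mfderiv_orbit_mulInvariantVectorField (n := n) x v (γ s)
      rw [hv, map_zero] at h3
      exact h2.congr_mfderiv (ContinuousLinearMap.comp_smulRight_one _ h3)
    have h2 : IsMIntegralCurve (I := 𝓡 n) (fun _ : ℝ => x)
        (fun p => (0 : TangentSpace (𝓡 n) p)) := isMIntegralCurve_const rfl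
    have h3 := isMIntegralCurve_Ioo_eq_of_contMDiff_boundaryless (t₀ := 0) hz h1 h2
      (by simp [hγ0])
    exact congrFun h3 t

end

/-! ### The S-curvature of a homogeneous Finsler space -/

section

variable {k n : ℕ} {G : Type*} [Group G] [TopologicalSpace G]
  [ChartedSpace (EuclideanSpace ℝ (Fin k)) G]
  {M : Type*} [TopologicalSpace M] [ChartedSpace (EuclideanSpace ℝ (Fin n)) M]
  [MulAction G M]

lemma IsFinslerOn.exists_isGeodesicFrom {F : TangentBundle (𝓡 n) M → ℝ}
    {e : OpenPartialHomeomorph M (EuclideanSpace ℝ (Fin n))}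
    (hL : IsFinslerOn (localMetric F e) e.target) {x : M} (hx : x ∈ e.source)
    {y : TangentSpace (𝓡 n) x} (hy : mfderiv (𝓡 n) (𝓡 n) e x y ≠ 0) :
    ∃ γ : ℝ → M, IsGeodesicFrom F e x y γ := by
  obtain ⟨c, hc0, hc1, hc⟩ := hL.exists_geodesic (e.map_source hx) hy
  have hec : ∀ᶠ t in 𝓝 (0 : ℝ), e (e.symm (c t)) = c t := hc.mono fun t ht => e.right_inv ht.1
  refine ⟨fun t => e.symm (c t), ?_, ?_, ?_⟩
  · filter_upwards [hc, hec.eventually_nhds] with t ht h1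
    have h2 : (fun s => e (e.symm (c s))) =ᶠ[𝓝 t] c := h1
    have h3 : deriv (fun s => e (e.symm (c s))) =ᶠ[𝓝 t] deriv c := h2.deriv
    refine ⟨e.map_target ht.1, ht.2.1.congr_of_eventuallyEq h2, ?_, ?_⟩
    · rw [h3.self_of_nhds]
      exact ht.2.2.1
    · rw [h3.self_of_nhds, h1.self_of_nhds]
      exact ht.2.2.2.congr_of_eventuallyEq h3
  · simp [hc0, e.left_inv hx]
  · have h2 : (fun s => e (e.symm (c s))) =ᶠ[𝓝 0] c := hec
    rw [h2.deriv_eq, hc1]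

variable [LieGroup (𝓡 k) ∞ G] [IsManifold (𝓡 n) ∞ M] [ContMDiffSMul (𝓡 k) (𝓡 n) ∞ G M]

/-- The identification of a complement `𝔪` of the isotropy algebra with the tangent space at `x`,
in the coordinates of a chart. It is the restriction of a map which vanishes on the isotropy algebra,
so the projection to `𝔪` may be dropped under it. -/
lemma exists_linearEquiv_complement [T2Space G] [SecondCountableTopology G] [T2Space M]
    [MulAction.IsPretransitive G M]
    {e : OpenPartialHomeomorph M (EuclideanSpace ℝ (Fin n))}
    (he : e ∈ IsManifold.maximalAtlas (𝓡 n) ∞ M) {x : M} (hx : x ∈ e.source)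
    {𝔪 : Submodule ℝ (GroupLieAlgebra (𝓡 k) G)}
    (h𝔪 : IsCompl 𝔪 (subgroupLieAlgebra (MulAction.stabilizer G x))) :
    ∃ T : 𝔪 ≃ₗ[ℝ] EuclideanSpace ℝ (Fin n),
      (∀ m : 𝔪, T m = actVec (actCoord k G e) (unitCoord k G) (e x)
        (m : GroupLieAlgebra (𝓡 k) G)) ∧
      ∀ v : GroupLieAlgebra (𝓡 k) G, T (Submodule.projectionOnto 𝔪 _ h𝔪 v) =
        actVec (actCoord k G e) (unitCoord k G) (e x) v := by
  set X := actVec (actCoord k G e) (unitCoord k G) (e x) with hX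
  have hker : ∀ v : GroupLieAlgebra (𝓡 k) G,
      v ∈ subgroupLieAlgebra (MulAction.stabilizer G x) ↔ X v = 0 := fun v => by
    rw [mem_subgroupLieAlgebra_stabilizer_iff (n := n) x v, hX, actVec_actCoord he hx]
    constructor
    · intro h
      exact (congrArg (mfderiv (𝓡 n) (𝓡 n) e x) h).trans (map_zero (mfderiv (𝓡 n) (𝓡 n) e x))
    · intro h
      exact (mdifferentiable_of_mem_maximalAtlas he).mfderiv_injective hx
        (h.trans (map_zero (mfderiv (𝓡 n) (𝓡 n) e x)).symm)
  have hproj : ∀ v : GroupLieAlgebra (𝓡 k) G,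
      X (Submodule.projectionOnto 𝔪 _ h𝔪 v : GroupLieAlgebra (𝓡 k) G) = X v := fun v => by
    have h1 : v - (Submodule.projectionOnto 𝔪 _ h𝔪 v : GroupLieAlgebra (𝓡 k) G) ∈
        subgroupLieAlgebra (MulAction.stabilizer G x) := by
      rw [← Submodule.projectionOnto_apply_eq_zero_iff h𝔪, map_sub,
        Submodule.projectionOnto_apply_left, sub_self]
    have h2 := (hker _).1 h1
    exact (sub_eq_zero.1 ((map_sub X v _).symm.trans h2)).symm
  let T₀ : 𝔪 →ₗ[ℝ] EuclideanSpace ℝ (Fin n) := X.toLinearMap ∘ₗ 𝔪.subtype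
  have hinj : Function.Injective T₀ := by
    rw [injective_iff_map_eq_zero]
    intro m hm
    have h1 : (m : GroupLieAlgebra (𝓡 k) G) ∈ 𝔪 ⊓ subgroupLieAlgebra (MulAction.stabilizer G x) :=
      ⟨m.2, (hker _).2 hm⟩
    rw [h𝔪.inf_eq_bot] at h1
    exact Subtype.ext h1
  have hsurj : Function.Surjective T₀ := fun z => by
    obtain ⟨v, hv⟩ := surjective_actVec (k := k) (G := G) he hx z
    exact ⟨Submodule.projectionOnto 𝔪 _ h𝔪 v, (hproj v).trans hv⟩
  exact ⟨LinearEquiv.ofBijective T₀ ⟨hinj, hsurj⟩, fun m => rfl, hproj⟩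

omit [LieGroup (𝓡 k) ∞ G] [IsManifold (𝓡 n) ∞ M] [ContMDiffSMul (𝓡 k) (𝓡 n) ∞ G M] in
lemma metricOn_eq_localMetric {e : OpenPartialHomeomorph M (EuclideanSpace ℝ (Fin n))}
    (he : e ∈ IsManifold.maximalAtlas (𝓡 n) ∞ M) {x : M} (hx : x ∈ e.source)
    (F : TangentBundle (𝓡 n) M → ℝ) (𝔪 : Submodule ℝ (GroupLieAlgebra (𝓡 k) G)) (m : 𝔪) :
    metricOn F x 𝔪 m = localMetric F e (e x)
      (mfderiv (𝓡 n) (𝓡 n) e x (fundVector x (m : GroupLieAlgebra (𝓡 k) G))) :=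
  congrArg F (tangentMap_symm_tangentMap he
    ⟨x, fundVector x (m : GroupLieAlgebra (𝓡 k) G)⟩ hx).symm

end

end Finsler

end

theorem theorem3 {k n : ℕ}
    {G : Type*} [Group G] [TopologicalSpace G] [T2Space G] [SecondCountableTopology G]
    [ChartedSpace (EuclideanSpace ℝ (Fin k)) G] [LieGroup (𝓡 k) ∞ G]
    {M : Type*} [TopologicalSpace M] [T2Space M]
    [ChartedSpace (EuclideanSpace ℝ (Fin n)) M] [IsManifold (𝓡 n) ∞ M]
    [MulAction G M] [ContMDiffSMul (𝓡 k) (𝓡 n) ∞ G M] [MulAction.IsPretransitive G M]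
    (F : TangentBundle (𝓡 n) M → ℝ) (hF : Finsler.IsFinslerMetric F)
    (hG : Finsler.ActsByIsometries G F) (x : M)
    (𝔪 : Submodule ℝ (GroupLieAlgebra (𝓡 k) G))
    (h𝔪 : IsCompl 𝔪 (Finsler.subgroupLieAlgebra (MulAction.stabilizer G x)))
    {ι : Type*} [Fintype ι] [DecidableEq ι] (b : Module.Basis ι ℝ 𝔪)
    (y : 𝔪) (hy : y ≠ 0) :
    Finsler.HasSCurvature F x (Finsler.fundVector x (y : GroupLieAlgebra (𝓡 k) G))
      (Finsler.fundTensor (Finsler.metricOn F x 𝔪) y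
        (Submodule.projectionOnto 𝔪 (Finsler.subgroupLieAlgebra (MulAction.stabilizer G x)) h𝔪
          ⁅(y : GroupLieAlgebra (𝓡 k) G),
            ((Finsler.gradLogSqrtDet (Finsler.metricOn F x 𝔪) b y : 𝔪) : GroupLieAlgebra (𝓡 k) G)⁆)
        y) := by
  intro e he hx
  obtain ⟨T, hT, hTproj⟩ := Finsler.exists_linearEquiv_complement he hx h𝔪
  have hact := Finsler.isLocalIsometricAction (k := k) he hx hF hG
  have hM := hact.finsler.minkowski _ hact.mem
  have hTy : T y ≠ 0 := T.map_ne_zero_iff.2 hy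
  have hTv : ∀ m : 𝔪, T m = mfderiv (𝓡 n) (𝓡 n) e x
      (Finsler.fundVector x (m : GroupLieAlgebra (𝓡 k) G)) := fun m =>
    (hT m).trans (Finsler.actVec_actCoord he hx _)
  have hmetric : Finsler.metricOn F x 𝔪 = fun m => Finsler.localMetric F e (e x) (T m) :=
    funext fun m => (Finsler.metricOn_eq_localMetric he hx F 𝔪 m).trans (by rw [hTv m])
  refine ⟨hact.finsler.exists_isGeodesicFrom hx (hTv y ▸ hTy), ?_⟩
  rintro γ ⟨hγ, hγ0, hγ1⟩
  obtain ⟨-, hd, -, hd2⟩ := hγ.self_of_nhds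
  rw [← hTv y] at hγ1
  rw [hγ0, hγ1] at hd2
  -- a section of the differential of the orbit map; with this choice of lift, the velocity of the
  -- lifted curve at the unit is `y`
  let J : EuclideanSpace ℝ (Fin n) →L[ℝ] EuclideanSpace ℝ (Fin k) :=
    LinearMap.toContinuousLinearMap (𝔪.subtype ∘ₗ T.symm.toLinearMap)
  have hJ : ∀ z, Finsler.actVec (Finsler.actCoord k G e) (Finsler.unitCoord k G) (e x) (J z) = z :=
    fun z => (hT (T.symm z)).symm.trans (T.apply_symm_apply z)
  have hJy : J (T y) = (y : GroupLieAlgebra (𝓡 k) G) :=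
    congrArg Subtype.val (T.symm_apply_apply y)
  have hder := hact.hasDerivAt_distortion hTy (c := fun t => e (γ t)) (by simp [hγ0])
    (hγ1 ▸ hd.hasDerivAt) hγ1 hd2 J hJ
  convert hder using 1
  set g : 𝔪 := Finsler.gradLogSqrtDet (Finsler.metricOn F x 𝔪) b y with hg
  have hgT : T g = Finsler.gradLogSqrtDet (Finsler.localMetric F e (e x)) (b.map T) (T y) := by
    rw [hg, hmetric]
    exact Finsler.gradLogSqrtDet_comp_linearEquiv _ T b y
  -- the Noether identity, applied to the gradient in the place of the second Lie algebra element
  have h1 := hact.fundTensor_sprayVert_sub hTy (hT y).symm (g : GroupLieAlgebra (𝓡 k) G)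
  have h2 := Finsler.actJac_sub_actJac hact.smooth Finsler.contDiffAt_mulCoord hact.one_act
    Finsler.mulCoord_unit_right Finsler.mulCoord_unit_left (Finsler.actCoord_mulCoord he hx)
    (y : GroupLieAlgebra (𝓡 k) G) (g : GroupLieAlgebra (𝓡 k) G)
  rw [← Finsler.bracket_eq_lieBracket_mulCoord] at h2
  rw [h2, ← hT g, ← hTproj, hgT, hM.fundTensor_gradLogSqrtDet hTy (b.map T),
    ← Finsler.fderiv_logSqrtDet_basis hM hTy (b.map T) (Finsler.stdBasis n)] at h1
  rw [hJy, h1, hmetric]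
  exact Finsler.fundTensor_comp_linearMap (Finsler.localMetric F e (e x)) T.toLinearMap y _ y
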